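/- Let $n\ge 3$ be odd and let $\Omega\subset\mathbb{R}^n$ be a bounded, strictly convex domain with smooth boundary (strictly convex: $\overline\Omega$ is strictly convex, i.e. $\partial\Omega$ contains no segments). For $f\in C^{n-1}(\overline\Omega)$ vanishing outside $\Omega$ and $0\le i\le\frac{n-1}{2}$, the values of $(-\Delta)^i f$ on $\partial\Omega$ are the continuous extensions from $\Omega$. Put $(-\Delta)^{\frac n2}:=(-\Delta)^{\frac12}\circ(-\Delta)^{\frac{n-1}{2}}$, where, for $w\in L^1_{loc}(\mathbb{R}^n)$ with $\int_{\mathbb{R}^n}\frac{|w(x)|}{1+|x|^{n+1}}\,dx<\infty$, $$(-\Delta)^{\frac12}w(x)=C_n\lim_{\delta\to0^+}\int_{\mathbb{R}^n\setminus B_\delta(x)}\frac{w(x)-w(y)}{|x-y|^{n+1}}\,dy,\qquad C_n=\frac{\Gamma(\frac{n+1}{2})}{\pi^{\frac{n+1}{2}}}.$$ Then for every $x^0\in\partial\Omega$, with unit inward normal $\nu^0$ of $\partial\Omega$ at $x^0$, there is $\delta_0>0$, depending only on $x^0$ and $\Omega$, with the following property. Let $p\ge1$, $q\ge1$, $pq>1$,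 and let $u,v:\mathbb{R}^n\to\mathbb{R}$, positive in $\Omega$ and belonging to $C^{n,\varepsilon}_{loc}(\Omega)\cap C^{n-1}(\overline\Omega)$ for some $\varepsilon\in(0,1)$, satisfy $$\begin{cases}(-\Delta)^{\frac n2}u(x)=v^p(x),\quad (-\Delta)^{\frac n2}v(x)=u^q(x), & x\in\Omega,\\ u(x)=-\Delta u(x)=\cdots=(-\Delta)^{\frac{n-1}{2}}u(x)=0, & x\in\mathbb{R}^n\setminus\Omega,\\ v(x)=-\Delta v(x)=\cdots=(-\Delta)^{\frac{n-1}{2}}v(x)=0, & x\in\mathbb{R}^n\setminus\Omega.\end{cases}$$ Then, for each $i=0,1,\dots,\frac{n-1}{2}$, the functions $(-\Delta)^i u$ and $(-\Delta)^i v$ are strictly increasing in the direction $\nu^0$ in $$\tilde\Sigma_{\delta_0}=\{x\in\overline\Omega \mid 0\le (x-x^0)\cdot\nu^0\le\delta_0\},$$ that is, $(-\Delta)^i u(x)<(-\Delta)^i u(x+t\nu^0)$ and $(-\Delta)^i v(x)<(-\Delta)^i v(x+t\nu^0)$ whenever $t>0$ and $x,\,x+t\nu^0\in\tilde\Sigma_{\delta_0}$.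 -/

import Mathlib

open scoped ContDiff Topology NNReal

noncomputable section

namespace LaneEmden

/-- `n`-dimensional Euclidean space. -/
abbrev E (n : ℕ) : Type := EuclideanSpace ℝ (Fin n)

/-! ### Domains -/

/-- `ρ` is a smooth defining function of `Ω` on the open neighbourhood `U` of the boundary point
`x₀`: inside `U`, `Ω` is `{ρ > 0}` and `∂Ω` is `{ρ = 0}`, and `∇ρ(x₀) ≠ 0`. -/
structure IsLocalDefiningFunction {n : ℕ} (Ω : Set (E n)) (x₀ : E n) (U : Set (E n))
    (ρ : E n → ℝ) : Prop where
  isOpen : IsOpen U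
  mem : x₀ ∈ U
  smooth : ContDiffOn ℝ ∞ ρ U
  gradient_ne_zero : gradient ρ x₀ ≠ 0
  mem_domain_iff : ∀ x ∈ U, x ∈ Ω ↔ 0 < ρ x
  mem_frontier_iff : ∀ x ∈ U, x ∈ frontier Ω ↔ ρ x = 0

/-- `Ω` has a smooth boundary. -/
def HasSmoothBoundary {n : ℕ} (Ω : Set (E n)) : Prop :=
  ∀ x₀ ∈ frontier Ω, ∃ (U : Set (E n)) (ρ : E n → ℝ), IsLocalDefiningFunction Ω x₀ U ρ

/-- `ν` is the unit inward normal of `∂Ω` at `x₀`: the normalized gradient of a smooth function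
that is positive inside `Ω` and vanishes on `∂Ω` near `x₀`. -/
def IsUnitInwardNormal {n : ℕ} (Ω : Set (E n)) (x₀ ν : E n) : Prop :=
  ∃ (U : Set (E n)) (ρ : E n → ℝ), IsLocalDefiningFunction Ω x₀ U ρ ∧
    ν = ‖gradient ρ x₀‖⁻¹ • gradient ρ x₀

/-- A bounded and strictly convex domain with smooth boundary. Strict convexity (no segments in
the boundary) is a condition on the closure: every open convex set is `StrictConvex`. -/
structure IsSmoothStrictlyConvexDomain {n : ℕ} (Ω : Set (E n)) : Prop where
  isOpen : IsOpen Ω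
  nonempty : Ω.Nonempty
  bounded : Bornology.IsBounded Ω
  convex : Convex ℝ Ω
  strictConvex_closure : StrictConvex ℝ (closure Ω)
  smooth_boundary : HasSmoothBoundary Ω

/-! ### Powers of the Laplacian -/

open scoped Classical in
/-- `-Δ f`, with one-sided derivatives from `Ω` at the points of `∂Ω`. At the points of `Ω` and at
the points outside `closure Ω` this is the usual `-Δ f`; on `∂Ω`, for `f` of class `C²` on
`closure Ω`, it is the continuous extension of `-Δ f` from `Ω`. -/
def negLaplacian {n : ℕ} (Ω : Set (E n)) (f : E n → ℝ) (x : E n) : ℝ :=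
  if x ∈ closure Ω then -InnerProductSpace.laplacianWithin f (closure Ω) x
  else -Laplacian.laplacian f x

/-- `(-Δ)^i f`, for `i` a natural number. -/
def negLaplacianPow {n : ℕ} (Ω : Set (E n)) (i : ℕ) (f : E n → ℝ) : E n → ℝ :=
  (negLaplacian Ω)^[i] f

/-- The space `𝓛_{2σ}`: locally integrable `f` with `∫ |f(x)| / (1 + |x|^{n+2σ}) dx < ∞`. -/
def MemFracSpace {n : ℕ} (σ : ℝ) (f : E n → ℝ) : Prop :=
  MeasureTheory.LocallyIntegrable f MeasureTheory.volume ∧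
    MeasureTheory.Integrable (fun x : E n => |f x| / (1 + ‖x‖ ^ ((n : ℝ) + 2 * σ)))
      MeasureTheory.volume

/-- The normalization constant `C_{n,σ} = 4^σ σ Γ(n/2+σ) / (π^{n/2} Γ(1-σ))`, for `0 < σ < 1`. -/
def fracConst (n : ℕ) (σ : ℝ) : ℝ :=
  4 ^ σ * σ * Real.Gamma ((n : ℝ) / 2 + σ) / (Real.pi ^ ((n : ℝ) / 2) * Real.Gamma (1 - σ))

/-- `f` belongs to `𝓛_{2σ}`, the principal value defining `(-Δ)^σ f(x)` exists, and
`(-Δ)^σ f(x) = L`. -/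
def HasFracLaplacianAt {n : ℕ} (σ : ℝ) (f : E n → ℝ) (x : E n) (L : ℝ) : Prop :=
  MemFracSpace σ f ∧
    Filter.Tendsto
      (fun δ : ℝ => fracConst n σ *
        ∫ y in (Metric.ball x δ)ᶜ, (f x - f y) / ‖x - y‖ ^ ((n : ℝ) + 2 * σ))
      (𝓝[>] 0) (𝓝 L)

/-- For odd `n`: `(-Δ)^{n/2} f(x) = L`, where `(-Δ)^{n/2} = (-Δ)^{1/2} ∘ (-Δ)^{(n-1)/2}`. -/
def HasHalfDimLaplacianAt {n : ℕ} (Ω : Set (E n)) (f : E n → ℝ) (x : E n) (L : ℝ) : Prop :=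
  HasFracLaplacianAt (1 / 2) (negLaplacianPow Ω ((n - 1) / 2) f) x L

/-! ### Solutions -/

/-- `f ∈ C^{k,ε}_loc(Ω)` for an open set `Ω`. -/
def MemHolderLoc {n : ℕ} (k : ℕ) (ε : ℝ≥0) (Ω : Set (E n)) (f : E n → ℝ) : Prop :=
  ContDiffOn ℝ k f Ω ∧
    ∀ K : Set (E n), K ⊆ Ω → IsCompact K →
      ∃ C : ℝ≥0, HolderOnWith C ε (iteratedFDeriv ℝ k f) K

/-- `f ∈ C^{n,ε}_loc(Ω) ∩ C^{n-1}(closure Ω)` for some `0 < ε < 1`. -/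
def IsClassical {n : ℕ} (Ω : Set (E n)) (f : E n → ℝ) : Prop :=
  (∃ ε : ℝ≥0, 0 < ε ∧ ε < 1 ∧ MemHolderLoc n ε Ω f) ∧
    ContDiffOn ℝ ((n - 1 : ℕ) : WithTop ℕ∞) f (closure Ω)

/-- `(u, v)` is a pair of positive classical solutions (`n` odd) of
`(-Δ)^{n/2} u = v^p`, `(-Δ)^{n/2} v = u^q` in `Ω`, with
`(-Δ)^i u = (-Δ)^i v = 0` in `ℝⁿ \ Ω` for `i = 0, …, (n-1)/2`. -/
structure IsPositiveClassicalSolution {n : ℕ} (Ω : Set (E n)) (p q : ℝ) (u v : E n → ℝ) :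
    Prop where
  classical_u : IsClassical Ω u
  classical_v : IsClassical Ω v
  pos_u : ∀ x ∈ Ω, 0 < u x
  pos_v : ∀ x ∈ Ω, 0 < v x
  eq_u : ∀ x ∈ Ω, HasHalfDimLaplacianAt Ω u x (v x ^ p)
  eq_v : ∀ x ∈ Ω, HasHalfDimLaplacianAt Ω v x (u x ^ q)
  navier_u : ∀ i ≤ (n - 1) / 2, ∀ x ∉ Ω, negLaplacianPow Ω i u x = 0
  navier_v : ∀ i ≤ (n - 1) / 2, ∀ x ∉ Ω, negLaplacianPow Ω i v x = 0

/-! ### Monotonicity in a boundary layer -/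

/-- The boundary layer `{x ∈ closure Ω | 0 ≤ (x - x₀) · ν ≤ δ}`. -/
def boundaryLayer {n : ℕ} (Ω : Set (E n)) (x₀ ν : E n) (δ : ℝ) : Set (E n) :=
  {x | x ∈ closure Ω ∧ 0 ≤ inner ℝ (x - x₀) ν ∧ inner ℝ (x - x₀) ν ≤ δ}

/-- `f` is strictly increasing along the direction `ν` in `S`. -/
def StrictlyIncreasingAlong {n : ℕ} (f : E n → ℝ) (ν : E n) (S : Set (E n)) : Prop :=
  ∀ x ∈ S, ∀ t : ℝ, 0 < t → x + t • ν ∈ S → f x < f (x + t • ν)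

end LaneEmden

end

noncomputable section

namespace LaneEmden

/-! ### Second order necessary conditions and the Laplacian -/

section Calculus

variable {F : Type*} [NormedAddCommGroup F] [InnerProductSpace ℝ F]

/-! The proof is a moving-plane argument on the whole chain `U i = (-Δ)^i u`, `i ≤ m = (n-1)/2`, and
likewise for `v`. The Navier conditions split the order `n` operator into second order equations `-Δ
(U i) = U (i+1)` and one half-Laplacian equation for `U m`. Every `U i` is continuous on the whole
space, zero off `Ω`, and positive in `Ω` (`IsNavierChain.pos`).

Reflect in the hyperplane of height `κ` along `ν` and let `w i` be the value of `U i` at the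
reflected point minus the value at the point. Low caps reflect into `Ω` (`exists_reflectsCaps`), so
the `w i` satisfy the differenced equations there. Positivity and the zero exterior values give `w i
≥ 0` in the half-space off the cap, at every level of the chain. A lower bound `-a` thus descends:
the antisymmetric nonlocal minimum principle (`exists_forall_neg_le_reflectionDiff_top`) costs a
factor `1/θ`, and each Laplacian costs the square of a width (`neg_mul_sq_le_of_narrow`).

If both differences at level `0` are nonnegative for one `κ`, the strong principle
(`IsNavierChain.reflectionDiff_pos`) makes them positive on a compact part of the cap. For slightly
larger heights they can be negative only near the complement of the new cap. There the last
Laplacian gains a small factor, which beats the Lipschitz constants of the powers, and any lower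
bound `-a` improves to `-a/2` (`reflectionDiff_nonneg_beyond`). Hence the plane advances from the
empty caps up to a height fixed by geometry alone. Two points on a line along `ν` are mirror images
in the plane halfway between them, so positive differences are strict monotonicity. -/

theorem deriv_deriv_nonneg_of_isLocalMin {f : ℝ → ℝ} {a : ℝ} (hc : ContinuousAt f a)
    (hf : IsLocalMin f a) : 0 ≤ deriv (deriv f) a := by
  by_contra! h
  -- A negative second derivative would make the minimum also a local maximum, so `f` would be
  -- locally constant.
  have hmax := isLocalMax_of_deriv_deriv_neg h hf.deriv_eq_zero hc
  have heq : f =ᶠ[𝓝 a] fun _ => f a := by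
    filter_upwards [hf, hmax] with x h1 h2 using le_antisymm h2 h1
  have h0 : deriv (deriv f) a = 0 := by
    rw [heq.deriv.deriv_eq]
    simp
  exact h.ne h0

theorem fderiv_fderiv_nonneg_of_isLocalMin {f : F → ℝ} {x : F} (hf : ContDiffAt ℝ 2 f x)
    (hmin : IsLocalMin f x) (w : F) : 0 ≤ fderiv ℝ (fderiv ℝ f) x w w := by
  set l : ℝ → F := fun t => x + t • w with hl
  have hl0 : l 0 = x := by simp [hl]
  have hlc : ContinuousAt l 0 := by fun_prop
  have hld : ∀ t, HasDerivAt l w t := fun t => by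
    simpa [hl] using ((hasDerivAt_id t).smul_const w).const_add x
  have hev : ∀ᶠ t in 𝓝 (0 : ℝ), DifferentiableAt ℝ f (l t) := by
    have h1 : ∀ᶠ y in 𝓝 x, DifferentiableAt ℝ f y :=
      (hf.eventually (by simp)).mono fun y hy => hy.differentiableAt (by simp)
    exact hlc.eventually (by rwa [hl0])
  have h1 : deriv (f ∘ l) =ᶠ[𝓝 0] fun t => fderiv ℝ f (l t) w := by
    filter_upwards [hev] with t ht
    exact (ht.hasFDerivAt.comp_hasDerivAt t (hld t)).deriv
  have h2 : DifferentiableAt ℝ (fderiv ℝ f) x :=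
    (hf.fderiv_right (m := 1) (by norm_num)).differentiableAt (by simp)
  have h3 : deriv (deriv (f ∘ l)) 0 = fderiv ℝ (fderiv ℝ f) x w w := by
    rw [h1.deriv_eq]
    have h4 : HasFDerivAt (fderiv ℝ f) (fderiv ℝ (fderiv ℝ f) x) (l 0) := by
      rw [hl0]; exact h2.hasFDerivAt
    have h5 := h4.comp_hasDerivAt 0 (hld 0)
    exact (h5.clm_apply (hasDerivAt_const 0 w)).deriv.trans (by simp)
  rw [← h3]
  apply deriv_deriv_nonneg_of_isLocalMin
  · exact (hf.continuousAt.comp_of_eq hlc hl0)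
  · have h6 : ∀ᶠ t in 𝓝 (0 : ℝ), f x ≤ f (l t) := hlc.eventually (by rw [hl0]; exact hmin)
    simpa [IsLocalMin, IsMinFilter, hl0] using h6

variable [FiniteDimensional ℝ F]

theorem laplacian_nonneg_of_isLocalMin {f : F → ℝ} {x : F} (hf : ContDiffAt ℝ 2 f x)
    (hmin : IsLocalMin f x) : 0 ≤ Laplacian.laplacian f x := by
  rw [InnerProductSpace.laplacian_eq_iteratedFDeriv_stdOrthonormalBasis]
  refine Finset.sum_nonneg fun i _ => ?_
  rw [iteratedFDeriv_two_apply]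
  exact fderiv_fderiv_nonneg_of_isLocalMin hf hmin _

/-- The chain rule turns second derivatives along `b` into those along `b.map L`, and the Laplacian
may be computed in any orthonormal basis. -/
theorem laplacian_comp_linearIsometryEquiv_add (f : F → ℝ) (L : F ≃ₗᵢ[ℝ] F) (c x : F) :
    Laplacian.laplacian (fun y => f (L y + c)) x = Laplacian.laplacian f (L x + c) := by
  set b := stdOrthonormalBasis ℝ F
  have h1 : (fun y => f (L y + c)) = (fun z => f (z + c)) ∘ L.toContinuousLinearEquiv := rfl
  rw [InnerProductSpace.laplacian_eq_iteratedFDeriv_orthonormalBasis _ b,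
    InnerProductSpace.laplacian_eq_iteratedFDeriv_orthonormalBasis _ (b.map L)]
  refine Finset.sum_congr rfl fun i _ => ?_
  rw [h1, ← iteratedFDerivWithin_univ, ← Set.preimage_univ (f := L.toContinuousLinearEquiv),
    ContinuousLinearEquiv.iteratedFDerivWithin_comp_right _ _ uniqueDiffOn_univ (Set.mem_univ _),
    iteratedFDerivWithin_univ, iteratedFDeriv_comp_add_right]
  simp only [ContinuousMultilinearMap.compContinuousLinearMap_apply, OrthonormalBasis.map_apply]
  congr 1
  ext j
  fin_cases j <;> rfl

theorem laplacian_quadratic (e z : F) (he : ‖e‖ = 1) (a b : ℝ) (x : F) :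
    Laplacian.laplacian (fun y : F => a * inner ℝ e (y - z) + b * inner ℝ e (y - z) ^ 2) x
      = 2 * b := by
  have h1 : ∀ y : F, HasFDerivAt (fun y : F => inner ℝ e (y - z)) (innerSL ℝ e) y := fun y =>
    (innerSL ℝ e).hasFDerivAt.comp y ((hasFDerivAt_id y).sub_const z)
  have h2 : fderiv ℝ (fun y : F => a * inner ℝ e (y - z) + b * inner ℝ e (y - z) ^ 2)
      = fun y => (a + 2 * b * inner ℝ e (y - z)) • innerSL ℝ e := by
    ext1 y
    have h3 := ((h1 y).const_mul a).add (((h1 y).pow 2).const_mul b)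
    refine (HasFDerivAt.fderiv h3).trans ?_
    ext w
    simp
    ring
  have h4 : fderiv ℝ (fun y : F => (a + 2 * b * inner ℝ e (y - z)) • innerSL ℝ e) x
      = ((2 * b) • innerSL ℝ e).smulRight (innerSL ℝ e) :=
    ((((h1 x).const_mul (2 * b)).const_add a).smul_const (innerSL ℝ e)).fderiv
  rw [InnerProductSpace.laplacian_eq_iteratedFDeriv_stdOrthonormalBasis]
  simp only [iteratedFDeriv_two_apply, h2, h4]
  have h5 := (stdOrthonormalBasis ℝ F).sum_inner_mul_inner e e
  rw [real_inner_self_eq_norm_sq, he] at h5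
  simp only [Matrix.cons_val_zero, Matrix.cons_val_one, ContinuousLinearMap.smulRight_apply,
    smul_apply, innerSL_apply_apply, smul_eq_mul]
  calc _ = 2 * b * ∑ i, inner ℝ e (stdOrthonormalBasis ℝ F i) *
        inner ℝ (stdOrthonormalBasis ℝ F i) e := by
        rw [Finset.mul_sum]
        refine Finset.sum_congr rfl fun i _ => ?_
        rw [real_inner_comm e]
        ring
    _ = _ := by rw [h5]; ring

end Calculus

/-! ### Minimum principle in narrow convex domains -/

section NarrowDomain

variable {F : Type*} [NormedAddCommGroup F] [InnerProductSpace ℝ F] [FiniteDimensional ℝ F]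

/-- A nonempty proper open convex set lies on one side of a hyperplane through any point of its
complement. -/
theorem exists_unit_inner_pos {D : Set F} (hDo : IsOpen D) (hDc : Convex ℝ D)
    (hDn : D.Nonempty) {z : F} (hz : z ∉ D) :
    ∃ e : F, ‖e‖ = 1 ∧ ∀ y ∈ D, 0 < inner ℝ e (y - z) := by
  obtain ⟨f, hf⟩ := geometric_hahn_banach_open_point hDc hDo hz
  set g := (InnerProductSpace.toDual ℝ F).symm f with hg
  have hgi : ∀ y, inner ℝ g y = f y := fun y => InnerProductSpace.toDual_symm_apply
  obtain ⟨y₀, hy₀⟩ := hDn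
  have hg0 : g ≠ 0 := by
    intro h0
    have := hf y₀ hy₀
    rw [← hgi, ← hgi, h0] at this
    simp at this
  have hn : 0 < ‖g‖ := norm_pos_iff.mpr hg0
  refine ⟨-(‖g‖⁻¹ • g), ?_, fun y hy => ?_⟩
  · rw [norm_neg, norm_smul, norm_inv, norm_norm, inv_mul_cancel₀ hn.ne']
  · rw [inner_neg_left, real_inner_smul_left, inner_sub_right, hgi, hgi]
    have := hf y hy
    have h2 : 0 < ‖g‖⁻¹ := inv_pos.mpr hn
    nlinarith

/-- Minimum principle for `-Δ U ≥ -A` in a bounded convex open set `D`, with `U ≥ 0` on `∂D`, when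
the points of `D` at which `U < 0` have distance less than `ε` to the complement of `D`. -/
theorem neg_mul_sq_le_of_narrow {D : Set F} (hDo : IsOpen D) (hDc : Convex ℝ D)
    (hDb : Bornology.IsBounded D) {U : F → ℝ} {A ε : ℝ} (hA : 0 ≤ A) (hε : 0 < ε)
    (hUc : ContinuousOn U (closure D)) (hU2 : ∀ x ∈ D, ContDiffAt ℝ 2 U x)
    (hUf : ∀ x ∈ frontier D, 0 ≤ U x) (hUA : ∀ x ∈ D, Laplacian.laplacian U x ≤ A)
    (hnarrow : ∀ x ∈ D, U x < 0 → ∃ z ∉ D, ‖x - z‖ < ε) :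
    ∀ x ∈ D, -(A * ε ^ 2) ≤ U x := by
  intro x₁ hx₁
  have hcomp : IsCompact (closure D) := hDb.isCompact_closure
  obtain ⟨xs, hxs, hmin⟩ := hcomp.exists_isMinOn ⟨x₁, subset_closure hx₁⟩ hUc
  by_contra! hlt
  have hAe : 0 ≤ A * ε ^ 2 := by positivity
  have hxsU : U xs < -(A * ε ^ 2) := lt_of_le_of_lt (hmin (subset_closure hx₁)) hlt
  have hxsD : xs ∈ D := by
    by_contra hnot
    have : xs ∈ frontier D := by
      rw [hDo.frontier_eq]; exact ⟨hxs, hnot⟩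
    linarith [hUf xs this]
  obtain ⟨z, hzD, hz⟩ := hnarrow xs hxsD (by linarith)
  obtain ⟨e, he, hpos⟩ := exists_unit_inner_pos hDo hDc ⟨xs, hxsD⟩ hzD
  have hcl : ∀ y ∈ closure D, 0 ≤ inner ℝ e (y - z) := by
    intro y hy
    have hc : IsClosed {y : F | 0 ≤ inner ℝ e (y - z)} :=
      isClosed_le continuous_const (by fun_prop)
    exact closure_minimal (fun w hw => (hpos w hw).le) hc hy
  set b := -U xs with hb
  have hbpos : 0 < b := by rw [hb]; linarith
  -- The room between `A` and `A'` makes the differential inequality at the end strict.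
  obtain ⟨A', hA', hA'b⟩ : ∃ A', A < A' ∧ A' * ε ^ 2 < b := by
    have h1 : A < b / ε ^ 2 := by rw [lt_div_iff₀ (by positivity)]; rw [hb]; linarith
    obtain ⟨A', h2, h3⟩ := exists_between h1
    exact ⟨A', h2, by rwa [lt_div_iff₀ (by positivity)] at h3⟩
  have hA'0 : 0 < A' := lt_of_le_of_lt hA hA'
  -- A barrier on the strip `0 ≤ s ≤ 2ε` along the supporting hyperplane at `z`, with `s = ⟪e, y -
  -- z⟫`. It has Laplacian `-A'`, satisfies `P ≥ b s / (2ε)` on the strip, hence `P ≥ b` on the far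
  -- side, and `P < b` at `xs`, where `s < ε`.
  set P : F → ℝ := fun y => (b / (2 * ε) + A' * ε) * inner ℝ e (y - z)
    + (-(A' / 2)) * inner ℝ e (y - z) ^ 2 with hP
  have hPc : ContDiff ℝ 2 P := by
    rw [hP]
    have : ContDiff ℝ 2 fun y : F => (inner ℝ e (y - z) : ℝ) :=
      contDiff_const.inner ℝ (contDiff_id.sub contDiff_const)
    exact (contDiff_const.mul this).add (contDiff_const.mul (this.pow 2))
  have hxl : inner ℝ e (xs - z) < ε :=
    lt_of_le_of_lt ((real_inner_le_norm _ _).trans (by rw [he, one_mul])) hz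
  have hxp : 0 < inner ℝ e (xs - z) := hpos xs hxsD
  set S : Set F := closure D ∩ {y | inner ℝ e (y - z) ≤ 2 * ε} with hS
  have hSc : IsCompact S := hcomp.inter_right (isClosed_le (by fun_prop) continuous_const)
  obtain ⟨y, hyS, hymin⟩ := hSc.exists_isMinOn (f := fun y => U y + P y)
    ⟨xs, hxs, by simp only [Set.mem_ofPred_eq]; linarith⟩
    ((hUc.mono Set.inter_subset_left).add hPc.continuous.continuousOn)
  have hxsneg : U xs + P xs < 0 := by
    simp only [hP]
    have h1 : U xs = -b := by rw [hb]; ring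
    have h2 : b / (2 * ε) * inner ℝ e (xs - z) ≤ b / (2 * ε) * ε := by gcongr
    have h3 : b / (2 * ε) * ε = b / 2 := by field_simp
    have h4 : A' * (ε * inner ℝ e (xs - z) - inner ℝ e (xs - z) ^ 2 / 2) ≤ A' * (ε ^ 2 / 2) := by
      gcongr
      nlinarith [sq_nonneg (ε - inner ℝ e (xs - z))]
    nlinarith
  have hyneg : U y + P y < 0 :=
    lt_of_le_of_lt (hymin ⟨hxs, by simp only [Set.mem_ofPred_eq]; linarith⟩) hxsneg
  obtain ⟨hyc, hy2⟩ := hyS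
  simp only [Set.mem_ofPred_eq] at hy2
  have hy0 : 0 ≤ inner ℝ e (y - z) := hcl y hyc
  have hPy : b / (2 * ε) * inner ℝ e (y - z) ≤ P y := by
    simp only [hP]
    have : 0 ≤ A' * (inner ℝ e (y - z) * (2 * ε - inner ℝ e (y - z))) := by
      apply mul_nonneg hA'0.le; apply mul_nonneg hy0; linarith
    nlinarith
  have hbe : 0 < b / (2 * ε) := by positivity
  -- The negative minimum of `U + P` over the strip avoids `∂D`, where both terms are nonnegative,
  -- and the side `s = 2ε`, where `U ≥ -b` and `P ≥ b`. At the remaining interior minimum the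
  -- Laplacian is at most `A - A' < 0`.
  have hyD : y ∈ D := by
    by_contra hnot
    have : y ∈ frontier D := by rw [hDo.frontier_eq]; exact ⟨hyc, hnot⟩
    have h1 := hUf y this
    have h2 := mul_nonneg hbe.le hy0
    linarith
  have hylt : inner ℝ e (y - z) < 2 * ε := by
    refine lt_of_le_of_ne hy2 fun heq => ?_
    have h1 : U xs ≤ U y := hmin hyc
    rw [heq] at hPy
    have h3 : b / (2 * ε) * (2 * ε) = b := by field_simp
    rw [h3] at hPy
    rw [hb] at hPy
    linarith
  have hloc : IsLocalMin (U + P) y := by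
    have hopen : IsOpen (D ∩ {y | inner ℝ e (y - z) < 2 * ε}) :=
      hDo.inter (isOpen_lt (by fun_prop) continuous_const)
    filter_upwards [hopen.mem_nhds ⟨hyD, hylt⟩] with w hw
    exact hymin ⟨subset_closure hw.1, (show inner ℝ e (w - z) < 2 * ε from hw.2).le⟩
  have hL := laplacian_nonneg_of_isLocalMin (f := U + P)
    ((hU2 y hyD).add hPc.contDiffAt) hloc
  rw [(hU2 y hyD).laplacian_add hPc.contDiffAt, hP, laplacian_quadratic e z he] at hL
  linarith [hUA y hyD]

end NarrowDomain

/-! ### The chain of iterated Laplacians -/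

section Chain

variable {n : ℕ} {Ω : Set (E n)}

theorem negLaplacian_of_mem {Ω : Set (E n)} (hΩ : IsOpen Ω)
    (hu : UniqueDiffOn ℝ (closure Ω)) (f : E n → ℝ) {x : E n} (hx : x ∈ Ω) :
    negLaplacian Ω f x = -Laplacian.laplacian f x := by
  have hxc : x ∈ closure Ω := subset_closure hx
  have hnhds : closure Ω =ᶠ[𝓝 x] Set.univ := by
    rw [Filter.eventuallyEq_univ]
    exact Filter.mem_of_superset (hΩ.mem_nhds hx) subset_closure
  rw [negLaplacian, if_pos hxc,
    InnerProductSpace.laplacianWithin_eq_iteratedFDerivWithin_stdOrthonormalBasis f hu hxc,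
    InnerProductSpace.laplacian_eq_iteratedFDeriv_stdOrthonormalBasis]
  simp only [iteratedFDerivWithin_congr_set hnhds, iteratedFDerivWithin_univ]

theorem contDiffOn_negLaplacian (hu : UniqueDiffOn ℝ (closure Ω)) {f : E n → ℝ} {k : ℕ}
    (hf : ContDiffOn ℝ ((k + 2 : ℕ) : WithTop ℕ∞) f (closure Ω)) :
    ContDiffOn ℝ (k : WithTop ℕ∞) (negLaplacian Ω f) (closure Ω) := by
  have h1 : ContDiffOn ℝ (k : WithTop ℕ∞) (iteratedFDerivWithin ℝ 2 f (closure Ω)) (closure Ω) :=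
    fun x hx => (hf x hx).iteratedFDerivWithin_right hu (by norm_cast) hx
  have h2 : ContDiffOn ℝ (k : WithTop ℕ∞) (fun x => -∑ i, iteratedFDerivWithin ℝ 2 f (closure Ω) x
      ![stdOrthonormalBasis ℝ (E n) i, stdOrthonormalBasis ℝ (E n) i]) (closure Ω) := by
    refine (ContDiffOn.sum fun i _ => ?_).neg
    exact (ContinuousMultilinearMap.apply ℝ (fun _ : Fin 2 => E n) ℝ
      ![stdOrthonormalBasis ℝ (E n) i, stdOrthonormalBasis ℝ (E n) i]).contDiff.comp_contDiffOn h1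
  refine h2.congr fun x hx => ?_
  rw [negLaplacian, if_pos hx,
    InnerProductSpace.laplacianWithin_eq_iteratedFDerivWithin_stdOrthonormalBasis f hu hx]

theorem negLaplacianPow_succ (i : ℕ) (f : E n → ℝ) :
    negLaplacianPow Ω (i + 1) f = negLaplacian Ω (negLaplacianPow Ω i f) :=
  Function.iterate_succ_apply' _ _ _

theorem contDiffOn_negLaplacianPow (hu : UniqueDiffOn ℝ (closure Ω)) {f : E n → ℝ} {m : ℕ}
    (hf : ContDiffOn ℝ ((2 * m : ℕ) : WithTop ℕ∞) f (closure Ω)) {i : ℕ} (hi : i ≤ m) :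
    ContDiffOn ℝ ((2 * (m - i) : ℕ) : WithTop ℕ∞) (negLaplacianPow Ω i f) (closure Ω) := by
  induction i with
  | zero => simpa [negLaplacianPow] using hf
  | succ i ih =>
    rw [negLaplacianPow_succ]
    apply contDiffOn_negLaplacian hu
    have h1 : 2 * (m - (i + 1)) + 2 = 2 * (m - i) := by omega
    rw [h1]
    exact ih (by omega)

/-- The closed sets `closure Ω` and `Ωᶜ` cover the space, and `f` is continuous on each. -/
theorem continuous_of_continuousOn_closure {f : E n → ℝ} (hΩ : IsOpen Ω)
    (hf : ContinuousOn f (closure Ω)) (h0 : ∀ x ∉ Ω, f x = 0) : Continuous f := by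
  rw [← continuousOn_univ]
  have h1 : ContinuousOn f Ωᶜ := (continuousOn_const (c := (0 : ℝ))).congr h0
  have h2 := hf.union_of_isClosed h1 isClosed_closure hΩ.isClosed_compl
  exact h2.mono fun x _ => by
    by_cases hx : x ∈ Ω
    · exact Or.inl (subset_closure hx)
    · exact Or.inr hx

/-- The functions `U i = (-Δ)^i u`, `i ≤ m`, all vanish outside `Ω`, and `(-Δ)^{1/2} (U m) = g` in
`Ω`. -/
structure IsNavierChain (Ω : Set (E n)) (m : ℕ) (U : ℕ → E n → ℝ) (g : E n → ℝ) : Prop where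
  continuous : ∀ i ≤ m, Continuous (U i)
  contDiffAt : ∀ i < m, ∀ x ∈ Ω, ContDiffAt ℝ 2 (U i) x
  laplacian : ∀ i < m, ∀ x ∈ Ω, Laplacian.laplacian (U i) x = -U (i + 1) x
  eq_zero : ∀ i ≤ m, ∀ x ∉ Ω, U i x = 0
  frac : ∀ x ∈ Ω, HasFracLaplacianAt (1 / 2) (U m) x (g x)

theorem isNavierChain_negLaplacianPow (hodd : Odd n)
    (hΩ : IsSmoothStrictlyConvexDomain Ω) {u g : E n → ℝ} (hu : IsClassical Ω u)
    (hg : ∀ x ∈ Ω, HasHalfDimLaplacianAt Ω u x (g x))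
    (h0 : ∀ i ≤ (n - 1) / 2, ∀ x ∉ Ω, negLaplacianPow Ω i u x = 0) :
    IsNavierChain Ω ((n - 1) / 2) (fun i => negLaplacianPow Ω i u) g := by
  have hud : UniqueDiffOn ℝ (closure Ω) := by
    refine uniqueDiffOn_convex hΩ.convex.closure ?_
    exact hΩ.nonempty.mono (interior_maximal subset_closure hΩ.isOpen)
  -- Oddness of `n` makes `C^{n-1}` exactly `C^{2m}`: each Laplacian uses up two derivatives, and
  -- the top function is still continuous up to the boundary.
  have hm : n - 1 = 2 * ((n - 1) / 2) := by
    obtain ⟨k, hk⟩ := hodd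
    omega
  have hreg : ContDiffOn ℝ ((2 * ((n - 1) / 2) : ℕ) : WithTop ℕ∞) u (closure Ω) := by
    rw [← hm]; exact hu.2
  refine ⟨fun i hi => ?_, fun i hi x hx => ?_, fun i hi x hx => ?_, h0, hg⟩
  · exact continuous_of_continuousOn_closure hΩ.isOpen
      (contDiffOn_negLaplacianPow hud hreg hi).continuousOn (h0 i hi)
  · have h1 := (contDiffOn_negLaplacianPow hud hreg hi.le).contDiffAt
      (Filter.mem_of_superset (hΩ.isOpen.mem_nhds hx) subset_closure)
    refine h1.of_le ?_
    have : 2 ≤ 2 * ((n - 1) / 2 - i) := by omega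
    exact_mod_cast this
  · simp only [negLaplacianPow_succ]
    rw [negLaplacian_of_mem hΩ.isOpen hud _ hx, neg_neg]

end Chain

/-! ### Reflections in hyperplanes -/

section Reflection

variable {n : ℕ} {ν : E n} {κ : ℝ}

/-- The reflection in the hyperplane `{x | ⟪x, ν⟫ = κ}`, for a unit vector `ν`. -/
def planeReflection (ν : E n) (κ : ℝ) (x : E n) : E n :=
  x + (2 * (κ - inner ℝ x ν)) • ν

theorem planeReflection_eq (hν : ‖ν‖ = 1) (κ : ℝ) (x : E n) :
    planeReflection ν κ x = (ℝ ∙ ν)ᗮ.reflection x + (2 * κ) • ν := by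
  rw [Submodule.reflection_orthogonal_apply, Submodule.reflection_singleton_apply,
    planeReflection, hν, real_inner_comm]
  module

theorem inner_planeReflection (hν : ‖ν‖ = 1) (κ : ℝ) (x : E n) :
    inner ℝ (planeReflection ν κ x) ν = 2 * κ - inner ℝ x ν := by
  rw [planeReflection, inner_add_left, real_inner_smul_left, real_inner_self_eq_norm_sq, hν]
  ring

theorem planeReflection_planeReflection (hν : ‖ν‖ = 1) (κ : ℝ) (x : E n) :
    planeReflection ν κ (planeReflection ν κ x) = x := by
  rw [planeReflection, inner_planeReflection hν, planeReflection]
  module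

theorem norm_planeReflection_sub (hν : ‖ν‖ = 1) (κ : ℝ) (x y : E n) :
    ‖planeReflection ν κ x - planeReflection ν κ y‖ = ‖x - y‖ := by
  rw [planeReflection_eq hν, planeReflection_eq hν, add_sub_add_right_eq_sub, ← map_sub,
    LinearIsometryEquiv.norm_map]

/-- The source of every kernel comparison: the extra term is positive when `x` and `y` lie strictly
on the same side of the hyperplane. -/
theorem norm_sub_planeReflection_sq (hν : ‖ν‖ = 1) (κ : ℝ) (x y : E n) :
    ‖x - planeReflection ν κ y‖ ^ 2
      = ‖x - y‖ ^ 2 + 4 * ((κ - inner ℝ x ν) * (κ - inner ℝ y ν)) := by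
  have h1 : x - planeReflection ν κ y = (x - y) - (2 * (κ - inner ℝ y ν)) • ν := by
    rw [planeReflection]; abel
  rw [h1, norm_sub_sq_real, real_inner_smul_right, inner_sub_left, norm_smul, hν, mul_one,
    Real.norm_eq_abs, sq_abs]
  ring

theorem norm_sub_le_norm_sub_planeReflection (hν : ‖ν‖ = 1) {x y : E n}
    (hx : inner ℝ x ν ≤ κ) (hy : inner ℝ y ν ≤ κ) :
    ‖x - y‖ ≤ ‖x - planeReflection ν κ y‖ := by
  refine le_of_sq_le_sq ?_ (norm_nonneg _)
  rw [norm_sub_planeReflection_sq hν]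
  nlinarith [mul_nonneg (sub_nonneg.mpr hx) (sub_nonneg.mpr hy)]

theorem norm_sub_lt_norm_sub_planeReflection (hν : ‖ν‖ = 1) {x y : E n}
    (hx : inner ℝ x ν < κ) (hy : inner ℝ y ν < κ) :
    ‖x - y‖ < ‖x - planeReflection ν κ y‖ := by
  refine lt_of_pow_lt_pow_left₀ 2 (norm_nonneg _) ?_
  rw [norm_sub_planeReflection_sq hν]
  nlinarith [mul_pos (sub_pos.mpr hx) (sub_pos.mpr hy)]

theorem isometry_planeReflection (hν : ‖ν‖ = 1) (κ : ℝ) : Isometry (planeReflection ν κ) :=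
  Isometry.of_dist_eq fun x y => by
    rw [dist_eq_norm, dist_eq_norm, norm_planeReflection_sub hν]

theorem continuous_planeReflection (hν : ‖ν‖ = 1) (κ : ℝ) : Continuous (planeReflection ν κ) :=
  (isometry_planeReflection hν κ).continuous

theorem measurePreserving_planeReflection (hν : ‖ν‖ = 1) (κ : ℝ) :
    MeasureTheory.MeasurePreserving (planeReflection ν κ) := by
  have h1 : planeReflection ν κ
      = (fun y => y + (2 * κ) • ν) ∘ (ℝ ∙ ν)ᗮ.reflection := by
    ext1 x; exact planeReflection_eq hν κ x
  rw [h1]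
  exact (MeasureTheory.measurePreserving_add_right _ _).comp
    (LinearIsometryEquiv.measurePreserving _)

theorem measurableEmbedding_planeReflection (hν : ‖ν‖ = 1) (κ : ℝ) :
    MeasurableEmbedding (planeReflection ν κ) :=
  (isometry_planeReflection hν κ).isClosedEmbedding.measurableEmbedding

theorem laplacian_comp_planeReflection (hν : ‖ν‖ = 1) (κ : ℝ) (f : E n → ℝ) (x : E n) :
    Laplacian.laplacian (fun y => f (planeReflection ν κ y)) x
      = Laplacian.laplacian f (planeReflection ν κ x) := by
  simp only [planeReflection_eq hν]
  exact laplacian_comp_linearIsometryEquiv_add f _ _ x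

theorem contDiff_planeReflection (ν : E n) (κ : ℝ) : ContDiff ℝ 2 (planeReflection ν κ) := by
  unfold planeReflection
  exact contDiff_id.add ((contDiff_const.mul
    (contDiff_const.sub (contDiff_id.inner ℝ contDiff_const))).smul contDiff_const)

end Reflection

/-! ### The half-Laplacian and antisymmetric functions -/

section HalfLaplacian

open MeasureTheory

variable {n : ℕ} {ν : E n} {κ : ℝ}

theorem integrableOn_inv_norm_rpow_compl_ball (x : E n) {δ s : ℝ} (hδ : 0 < δ) (hs : (n : ℝ) < s) :
    IntegrableOn (fun y : E n => (‖x - y‖ ^ s)⁻¹) (Metric.ball x δ)ᶜ := by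
  have hs0 : 0 < s := lt_of_le_of_lt (Nat.cast_nonneg n) hs
  have h1 : Integrable (fun y : E n => (1 + ‖y‖) ^ (-s)) :=
    integrable_one_add_norm (by simpa using hs)
  have h2 : Integrable (fun y : E n => (1 + ‖x - y‖) ^ (-s)) := h1.comp_sub_left x
  -- Off the ball, `1 + ‖x - y‖ ≤ (1 + 1/δ) ‖x - y‖`.
  refine ((h2.const_mul ((1 + 1 / δ) ^ s)).integrableOn (s := (Metric.ball x δ)ᶜ)).mono' ?_ ?_
  · exact (Measurable.aestronglyMeasurable (by fun_prop))
  · filter_upwards [ae_restrict_mem Metric.isOpen_ball.measurableSet.compl] with y hy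
    have hy1 : δ ≤ ‖x - y‖ := by
      simpa [dist_eq_norm, norm_sub_rev] using hy
    have hpos : 0 < ‖x - y‖ := hδ.trans_le hy1
    rw [Real.norm_of_nonneg (by positivity), Real.rpow_neg (by positivity), ← div_eq_mul_inv,
      ← Real.div_rpow (by positivity) (by positivity), ← Real.inv_rpow hpos.le]
    refine Real.rpow_le_rpow (by positivity) ?_ hs0.le
    rw [inv_eq_one_div, div_le_div_iff₀ hpos (by positivity)]
    have : 1 ≤ ‖x - y‖ / δ := by rwa [le_div_iff₀ hδ, one_mul]
    calc 1 * (1 + ‖x - y‖) ≤ ‖x - y‖ / δ + ‖x - y‖ := by linarith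
      _ = _ := by ring

theorem integrableOn_sub_div_norm_rpow_compl_ball {f : E n → ℝ} (hf : Continuous f) {M : ℝ}
    (hM : ∀ y, |f y| ≤ M) (x : E n) {δ s : ℝ} (hδ : 0 < δ) (hs : (n : ℝ) < s) :
    IntegrableOn (fun y : E n => (f x - f y) / ‖x - y‖ ^ s) (Metric.ball x δ)ᶜ := by
  refine ((integrableOn_inv_norm_rpow_compl_ball x hδ hs).const_mul (2 * M)).mono' ?_ ?_
  · exact (Measurable.aestronglyMeasurable (by
      have := hf.measurable
      fun_prop))
  · refine Filter.Eventually.of_forall fun y => ?_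
    rw [div_eq_mul_inv, norm_mul, Real.norm_of_nonneg (r := (‖x - y‖ ^ s)⁻¹) (by positivity)]
    gcongr
    rw [Real.norm_eq_abs]
    have h1 := abs_le.mp (hM x)
    have h2 := abs_le.mp (hM y)
    rw [abs_le]
    constructor <;> linarith

theorem fracConst_half_pos (hn : 0 < n) : 0 < fracConst n (1 / 2) := by
  unfold fracConst
  have h1 : 0 < Real.Gamma ((n : ℝ) / 2 + 1 / 2) := Real.Gamma_pos_of_pos (by positivity)
  have h2 : 0 < Real.Gamma (1 - 1 / 2) := Real.Gamma_pos_of_pos (by norm_num)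
  have := Real.pi_pos
  positivity

theorem HasFracLaplacianAt.nonpos_of_forall_le (hn : 0 < n) {f : E n → ℝ} {x : E n} {L : ℝ}
    (hL : HasFracLaplacianAt (1 / 2) f x L) (hmin : ∀ y, f x ≤ f y) : L ≤ 0 := by
  refine le_of_tendsto hL.2 (Filter.Eventually.of_forall fun δ => ?_)
  refine mul_nonpos_of_nonneg_of_nonpos (fracConst_half_pos hn).le ?_
  refine integral_nonpos fun y => ?_
  exact div_nonpos_of_nonpos_of_nonneg (sub_nonpos.mpr (hmin y)) (by positivity)

/-- The truncated integrals of `f ∘ R - f`, for the reflection `R` in a hyperplane. -/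
theorem HasFracLaplacianAt.tendsto_reflection_sub (hν : ‖ν‖ = 1) {f : E n → ℝ}
    (hf : Continuous f) {M : ℝ} (hM : ∀ y, |f y| ≤ M) {x : E n} {L₁ L₂ : ℝ}
    (h₁ : HasFracLaplacianAt (1 / 2) f (planeReflection ν κ x) L₁)
    (h₂ : HasFracLaplacianAt (1 / 2) f x L₂) :
    Filter.Tendsto (fun δ : ℝ => fracConst n (1 / 2) * ∫ y in (Metric.ball x δ)ᶜ,
        ((f (planeReflection ν κ x) - f x) - (f (planeReflection ν κ y) - f y))
          / ‖x - y‖ ^ ((n : ℝ) + 2 * (1 / 2)))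
      (𝓝[>] 0) (𝓝 (L₁ - L₂)) := by
  refine (h₁.2.sub h₂.2).congr' ?_
  filter_upwards [self_mem_nhdsWithin] with δ (hδ : 0 < δ)
  have hs : (n : ℝ) < (n : ℝ) + 2 * (1 / 2) := by norm_num
  rw [← mul_sub]
  congr 1
  have hpre : planeReflection ν κ ⁻¹' (Metric.ball (planeReflection ν κ x) δ)ᶜ
      = (Metric.ball x δ)ᶜ := by
    ext y
    simp [(isometry_planeReflection hν κ).dist_eq]
  have hint := integrableOn_sub_div_norm_rpow_compl_ball hf hM (planeReflection ν κ x) hδ hs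
  rw [← (measurePreserving_planeReflection hν κ).integrableOn_comp_preimage
    (measurableEmbedding_planeReflection hν κ), hpre] at hint
  rw [← (measurePreserving_planeReflection hν κ).setIntegral_preimage_emb
    (measurableEmbedding_planeReflection hν κ), hpre, ← integral_sub]
  · refine integral_congr_ae (Filter.Eventually.of_forall fun y => ?_)
    simp only [norm_planeReflection_sub hν]
    ring
  · exact hint
  · exact integrableOn_sub_div_norm_rpow_compl_ball hf hM x hδ hs

theorem tendsto_volume_ball_zero (hn : 0 < n) (x : E n) :
    Filter.Tendsto (fun δ : ℝ => volume (Metric.ball x δ)) (𝓝[>] 0) (𝓝 0) := by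
  have h1 : Filter.Tendsto (fun δ : ℝ => ENNReal.ofReal (δ ^ n) * volume (Metric.ball (0 : E n) 1))
      (𝓝[>] 0) (𝓝 0) := by
    have h2 : Filter.Tendsto (fun δ : ℝ => ENNReal.ofReal (δ ^ n)) (𝓝[>] 0) (𝓝 0) := by
      have h3 : Filter.Tendsto (fun δ : ℝ => δ ^ n) (𝓝[>] 0) (𝓝 0) := by
        have h4 : Filter.Tendsto (fun δ : ℝ => δ ^ n) (𝓝 0) (𝓝 (0 ^ n)) :=
          (continuous_pow n).tendsto 0
        rw [zero_pow hn.ne'] at h4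
        exact h4.mono_left nhdsWithin_le_nhds
      simpa using ENNReal.tendsto_ofReal h3
    simpa using ENNReal.Tendsto.mul_const h2 (Or.inr measure_ball_lt_top.ne)
  refine h1.congr' ?_
  filter_upwards [self_mem_nhdsWithin] with δ (hδ : 0 < δ)
  rw [Measure.addHaar_ball_of_pos _ _ hδ]
  simp

/-- An antisymmetric function `w` at a nonpositive minimum `x` over a half-space: an upper bound `t`
of the folded integrand on a part `A` of the half-space away from `x` bounds the half-Laplacian. -/
theorem le_of_antisymmetric_min (hn : 0 < n) (hν : ‖ν‖ = 1) {w : E n → ℝ}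
    (hw : Continuous w) {M : ℝ} (hM : ∀ y, |w y| ≤ M)
    (hanti : ∀ y, w (planeReflection ν κ y) = -w y) {x : E n} (hx : inner ℝ x ν < κ)
    (hx0 : w x ≤ 0) (hmin : ∀ y, inner ℝ y ν ≤ κ → w x ≤ w y) {L : ℝ}
    (hL : Filter.Tendsto (fun δ : ℝ => fracConst n (1 / 2) * ∫ y in (Metric.ball x δ)ᶜ,
      (w x - w y) / ‖x - y‖ ^ ((n : ℝ) + 2 * (1 / 2))) (𝓝[>] 0) (𝓝 L))
    {A : Set (E n)} (hA : MeasurableSet A) (hAκ : ∀ y ∈ A, inner ℝ y ν < κ) {r : ℝ} (hr : 0 < r)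
    (hAr : Disjoint A (Metric.ball x r)) (hAfin : volume A ≠ ⊤) {t : ℝ}
    (ht : ∀ y ∈ A, (w x - w y) / ‖x - y‖ ^ ((n : ℝ) + 2 * (1 / 2)) +
      (w x + w y) / ‖x - planeReflection ν κ y‖ ^ ((n : ℝ) + 2 * (1 / 2)) ≤ t) :
    L ≤ fracConst n (1 / 2) * (t * volume.real A) := by
  set R := planeReflection ν κ with hR
  set s : ℝ := (n : ℝ) + 2 * (1 / 2) with hsdef
  have hs : (n : ℝ) < s := by rw [hsdef]; norm_num
  have hs0 : 0 < s := lt_of_le_of_lt (Nat.cast_nonneg n) hs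
  set F : E n → ℝ := fun y => (w x - w y) / ‖x - y‖ ^ s with hF
  have hFR : ∀ y, F (R y) = (w x + w y) / ‖x - R y‖ ^ s := fun y => by
    simp only [hF, hanti, sub_neg_eq_add]
  set S : Set (E n) := {y | inner ℝ y ν < κ} with hS
  have hSo : IsOpen S := isOpen_lt (by fun_prop) continuous_const
  have hFle : ∀ y, inner ℝ y ν ≤ κ → F y ≤ 0 := fun y hy =>
    div_nonpos_of_nonpos_of_nonneg (sub_nonpos.mpr (hmin y hy)) (by positivity)
  -- The term with nonpositive numerator `w x - w y` carries the larger kernel, so the sum is at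
  -- most `2 w x / ‖x - R y‖ ^ s`. At `y = x` the first term vanishes.
  have hGle : ∀ y ∈ S, F y + F (R y) ≤ 0 := by
    intro y hy
    rcases eq_or_ne y x with rfl | hne
    · rw [hFR]
      simp only [hF, sub_self, zero_div, zero_add]
      exact div_nonpos_of_nonpos_of_nonneg (by linarith) (by positivity)
    have h1 : 0 < ‖x - y‖ := norm_pos_iff.mpr (sub_ne_zero.mpr hne.symm)
    have h2 : ‖x - y‖ ≤ ‖x - R y‖ := norm_sub_le_norm_sub_planeReflection hν hx.le (le_of_lt hy)
    have h3 : (‖x - R y‖ ^ s)⁻¹ ≤ (‖x - y‖ ^ s)⁻¹ := by gcongr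
    have h4 : 0 ≤ (‖x - R y‖ ^ s)⁻¹ := by positivity
    rw [hFR]
    simp only [hF, div_eq_mul_inv]
    have h5 : w x - w y ≤ 0 := sub_nonpos.mpr (hmin y (le_of_lt hy))
    nlinarith [mul_nonneg (neg_nonneg.mpr h5) (sub_nonneg.mpr h3),
      mul_nonneg (neg_nonneg.mpr hx0) h4]
  have hFint : ∀ δ, 0 < δ → IntegrableOn F (Metric.ball x δ)ᶜ := fun δ hδ =>
    integrableOn_sub_div_norm_rpow_compl_ball hw hM x hδ hs
  have hd : 0 < κ - inner ℝ x ν := sub_pos.mpr hx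
  have hballS : Metric.ball x (κ - inner ℝ x ν) ⊆ S := by
    intro y hy
    have h1 : inner ℝ (y - x) ν ≤ ‖y - x‖ := by
      simpa [hν] using real_inner_le_norm (y - x) ν
    rw [Metric.mem_ball, dist_eq_norm] at hy
    rw [inner_sub_left] at h1
    show inner ℝ y ν < κ
    linarith
  set S' : Set (E n) := {y | κ < inner ℝ y ν} with hS'
  have hS'o : IsOpen S' := isOpen_lt continuous_const (by fun_prop)
  have hpre : R ⁻¹' S' = S := by
    ext y
    show κ < inner ℝ (R y) ν ↔ inner ℝ y ν < κ
    rw [hR, inner_planeReflection hν]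
    constructor <;> intro h <;> linarith
  have hS'ball : S' ⊆ (Metric.ball x (κ - inner ℝ x ν))ᶜ := fun y (hy : κ < inner ℝ y ν) hyb =>
    absurd (hballS hyb) (not_lt.mpr hy.le)
  have hFS' : IntegrableOn F S' := (hFint _ hd).mono_set hS'ball
  have hFRS : IntegrableOn (fun y => F (R y)) S := by
    have := hFS'
    rw [← (measurePreserving_planeReflection hν κ).integrableOn_comp_preimage
      (measurableEmbedding_planeReflection hν κ), hpre] at this
    exact this
  -- Removing the ball around `x` does not remove its mirror image. That leftover vanishes in the
  -- limit, since `F ∘ R` is integrable over `S`.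
  have herr : Filter.Tendsto (fun δ : ℝ => ∫ y in Metric.ball x δ, F (R y) ∂(volume.restrict S))
      (𝓝[>] 0) (𝓝 0) := by
    refine Integrable.tendsto_setIntegral_nhds_zero hFRS ?_
    refine tendsto_of_tendsto_of_tendsto_of_le_of_le tendsto_const_nhds
      (tendsto_volume_ball_zero hn x) (fun _ => zero_le) fun δ => ?_
    exact Measure.restrict_le_self _
  have hlim : Filter.Tendsto (fun δ : ℝ => fracConst n (1 / 2) * (t * volume.real A +
      ∫ y in Metric.ball x δ, F (R y) ∂(volume.restrict S))) (𝓝[>] 0)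
      (𝓝 (fracConst n (1 / 2) * (t * volume.real A + 0))) :=
    (tendsto_const_nhds.add herr).const_mul _
  rw [add_zero] at hlim
  refine le_of_tendsto_of_tendsto hL hlim ?_
  filter_upwards [self_mem_nhdsWithin, nhdsWithin_le_nhds (Iio_mem_nhds hd),
    nhdsWithin_le_nhds (Iio_mem_nhds hr)] with δ (hδ : 0 < δ) (hδd : δ < _) (hδr : δ < r)
  refine mul_le_mul_of_nonneg_left ?_ (fracConst_half_pos hn).le
  set B := Metric.ball x δ with hB
  have hBm : MeasurableSet B := Metric.isOpen_ball.measurableSet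
  have hBS : B ⊆ S := (Metric.ball_subset_ball hδd.le).trans hballS
  have hFB := hFint δ hδ
  have hS'B : S' ⊆ Bᶜ := fun y (hy : κ < inner ℝ y ν) hyb =>
    absurd (hBS hyb) (not_lt.mpr hy.le)
  have e1 : ∫ y in Bᶜ, F y = (∫ y in S', F y) + ∫ y in Bᶜ \ S', F y := by
    rw [← setIntegral_union Set.disjoint_sdiff_right
      (hBm.compl.diff hS'o.measurableSet) hFS' (hFB.mono_set Set.sdiff_subset),
      Set.union_sdiff_cancel hS'B]
  have hSB : S \ B ⊆ Bᶜ \ S' := fun y hy => ⟨hy.2, fun h => by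
    have h1 : inner ℝ y ν < κ := hy.1
    have h2 : κ < inner ℝ y ν := h
    linarith⟩
  have e2 : ∫ y in Bᶜ \ S', F y ≤ ∫ y in S \ B, F y := by
    have h1 : ∫ y in S \ B, -F y ≤ ∫ y in Bᶜ \ S', -F y := by
      refine setIntegral_mono_set (hFB.mono_set Set.sdiff_subset).neg ?_ hSB.eventuallyLE
      filter_upwards [ae_restrict_mem (hBm.compl.diff hS'o.measurableSet)] with y hy
      exact neg_nonneg.mpr (hFle y (not_lt.mp hy.2))
    rw [integral_neg, integral_neg] at h1
    linarith
  have e3 : ∫ y in S', F y = ∫ y in S, F (R y) := by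
    rw [← (measurePreserving_planeReflection hν κ).setIntegral_preimage_emb
      (measurableEmbedding_planeReflection hν κ), hpre]
  have e4 : ∫ y in S, F (R y) = (∫ y in B, F (R y)) + ∫ y in S \ B, F (R y) := by
    rw [← setIntegral_union Set.disjoint_sdiff_right (hSo.measurableSet.diff hBm)
      (hFRS.mono_set hBS) (hFRS.mono_set Set.sdiff_subset), Set.union_sdiff_cancel hBS]
  have e5 : ∫ y in B, F (R y) ∂(volume.restrict S) = ∫ y in B, F (R y) := by
    rw [Measure.restrict_restrict hBm, Set.inter_eq_left.mpr hBS]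
  have hint : IntegrableOn (fun y => F y + F (R y)) (S \ B) :=
    (hFB.mono_set fun y hy => hy.2).add (hFRS.mono_set Set.sdiff_subset)
  have e6 : (∫ y in S \ B, F y) + ∫ y in S \ B, F (R y) = ∫ y in S \ B, (F y + F (R y)) :=
    (integral_add (hFB.mono_set fun y hy => hy.2) (hFRS.mono_set Set.sdiff_subset)).symm
  have hAS : A ⊆ S \ B := fun y hy => ⟨hAκ y hy, fun hyB =>
    Set.disjoint_left.mp hAr hy (Metric.ball_subset_ball hδr.le hyB)⟩
  -- The folded integrand is nonpositive, so shrinking the domain to `A` only increases the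
  -- integral.
  have e7 : ∫ y in S \ B, (F y + F (R y)) ≤ ∫ y in A, (F y + F (R y)) := by
    have h1 : ∫ y in A, -(F y + F (R y)) ≤ ∫ y in S \ B, -(F y + F (R y)) := by
      refine setIntegral_mono_set hint.neg ?_ hAS.eventuallyLE
      filter_upwards [ae_restrict_mem (hSo.measurableSet.diff hBm)] with y hy
      exact neg_nonneg.mpr (hGle y hy.1)
    rw [integral_neg, integral_neg] at h1
    linarith
  have e8 : ∫ y in A, (F y + F (R y)) ≤ t * volume.real A := by
    have h1 : ∫ y in A, (F y + F (R y)) ≤ ∫ _ in A, t :=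
      setIntegral_mono_on (hint.mono_set hAS) (integrableOn_const hAfin) hA fun y hy => by
        rw [hFR]; exact ht y hy
    rw [setIntegral_const, smul_eq_mul] at h1
    linarith
  rw [e5, e1, e3, e4]
  linarith

end HalfLaplacian

/-! ### Positivity -/

section Positivity

variable {n : ℕ} {Ω : Set (E n)}

/-- A minimizer over the compact closure that falls outside `D` has value at least `0`. Then `f x₁`
equals that value and `x₁` itself serves; this covers the borderline case `f x₁ = 0`. -/
theorem exists_min_of_nonpos {D S : Set (E n)} (hDb : Bornology.IsBounded D)
    (hDS : closure D ⊆ S) {f : E n → ℝ} (hf : Continuous f) (h0 : ∀ x ∈ S, x ∉ D → 0 ≤ f x)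
    {x₁ : E n} (hx₁ : x₁ ∈ D) (hfx : f x₁ ≤ 0) :
    ∃ y ∈ D, f y ≤ f x₁ ∧ ∀ z ∈ S, f y ≤ f z := by
  obtain ⟨y, hy, hmin⟩ := hDb.isCompact_closure.exists_isMinOn ⟨x₁, subset_closure hx₁⟩
    hf.continuousOn
  have hy1 : f y ≤ f x₁ := hmin (subset_closure hx₁)
  have hyz : ∀ z ∈ S, f y ≤ f z := fun z hz => by
    by_cases hzD : z ∈ D
    · exact hmin (subset_closure hzD)
    · linarith [h0 z hz hzD]
  by_cases hyD : y ∈ D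
  · exact ⟨y, hyD, hy1, hyz⟩
  · have h1 : f y = f x₁ := le_antisymm hy1 (hfx.trans (h0 y (hDS hy) hyD))
    exact ⟨x₁, hx₁, le_rfl, fun z hz => h1 ▸ hyz z hz⟩

/-- Descends from the top: a nonpositive value would give a global minimum inside `Ω`, where the
half-Laplacian is at most `0`, against `g > 0`, or the Laplacian is at least `0`, against positivity
one level up. -/
theorem IsNavierChain.pos {m : ℕ} {U : ℕ → E n → ℝ} {g : E n → ℝ}
    (h : IsNavierChain Ω m U g) (hn : 0 < n) (hΩb : Bornology.IsBounded Ω)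
    (hg : ∀ x ∈ Ω, 0 < g x) {i : ℕ} (hi : i ≤ m) : ∀ x ∈ Ω, 0 < U i x := by
  induction hi using Nat.decreasingInduction with
  | self =>
    intro x hx
    by_contra! hle
    obtain ⟨y, hy, -, hmin⟩ := exists_min_of_nonpos hΩb (Set.subset_univ _)
      (h.continuous m le_rfl) (fun z _ hz => (h.eq_zero m le_rfl z hz).ge) hx hle
    exact absurd ((h.frac y hy).nonpos_of_forall_le hn fun z => hmin z trivial)
      (not_le.mpr (hg y hy))
  | of_succ k hk ih =>
    intro x hx
    by_contra! hle
    obtain ⟨y, hy, -, hmin⟩ := exists_min_of_nonpos hΩb (Set.subset_univ _)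
      (h.continuous k hk.le) (fun z _ hz => (h.eq_zero k hk.le z hz).ge) hx hle
    have h1 := laplacian_nonneg_of_isLocalMin (h.contDiffAt k hk y hy)
      (Filter.Eventually.of_forall fun z => hmin z trivial)
    rw [h.laplacian k hk y hy] at h1
    linarith [ih y hy]

theorem IsNavierChain.nonneg {m : ℕ} {U : ℕ → E n → ℝ} {g : E n → ℝ}
    (h : IsNavierChain Ω m U g) (hn : 0 < n) (hΩb : Bornology.IsBounded Ω)
    (hg : ∀ x ∈ Ω, 0 < g x) {i : ℕ} (hi : i ≤ m) (x : E n) : 0 ≤ U i x := by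
  by_cases hx : x ∈ Ω
  · exact (h.pos hn hΩb hg hi x hx).le
  · exact (h.eq_zero i hi x hx).ge

theorem IsNavierChain.exists_bound {m : ℕ} {U : ℕ → E n → ℝ} {g : E n → ℝ}
    (h : IsNavierChain Ω m U g) (hΩb : Bornology.IsBounded Ω) {i : ℕ} (hi : i ≤ m) :
    ∃ M, 0 ≤ M ∧ ∀ x, |U i x| ≤ M := by
  obtain ⟨C, hC⟩ := hΩb.isCompact_closure.exists_bound_of_continuousOn
    (h.continuous i hi).continuousOn
  refine ⟨max C 0, le_max_right _ _, fun x => ?_⟩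
  by_cases hx : x ∈ Ω
  · exact (hC x (subset_closure hx)).trans (le_max_left _ _)
  · rw [h.eq_zero i hi x hx, abs_zero]
    exact le_max_right _ _

end Positivity

/-! ### Caps and reflected differences -/

section Caps

open MeasureTheory

variable {n : ℕ} {Ω : Set (E n)} {x₀ ν : E n} {κ κ₁ : ℝ}

/-- The part of `Ω` below the hyperplane `{x | ⟪x, ν⟫ = κ}`. -/
def cap (Ω : Set (E n)) (ν : E n) (κ : ℝ) : Set (E n) :=
  Ω ∩ {x | inner ℝ x ν < κ}

/-- `x₀` is a lowest point of `closure Ω` in the direction `ν`, and the reflections of the closed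
caps of height up to `κ₁` are contained in `Ω`. -/
structure ReflectsCaps (Ω : Set (E n)) (x₀ ν : E n) (κ₁ : ℝ) : Prop where
  norm_eq_one : ‖ν‖ = 1
  mem_closure : x₀ ∈ closure Ω
  not_mem : x₀ ∉ Ω
  inner_le : ∀ x ∈ closure Ω, inner ℝ x₀ ν ≤ inner ℝ x ν
  reflection_mem : ∀ κ ≤ κ₁, ∀ x ∈ closure Ω, inner ℝ x ν < κ → planeReflection ν κ x ∈ Ω

theorem isOpen_cap (hΩ : IsOpen Ω) : IsOpen (cap Ω ν κ) :=
  hΩ.inter (isOpen_lt (by fun_prop) continuous_const)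

theorem convex_cap (hΩ : Convex ℝ Ω) : Convex ℝ (cap Ω ν κ) := by
  refine hΩ.inter ?_
  have h1 : {x : E n | inner ℝ x ν < κ} = {x : E n | innerSL ℝ ν x < κ} := by
    ext x; simp [real_inner_comm]
  rw [h1]
  exact convex_halfSpace_lt (innerSL ℝ ν).isLinear κ

theorem isBounded_cap (hΩ : Bornology.IsBounded Ω) : Bornology.IsBounded (cap Ω ν κ) :=
  hΩ.subset Set.inter_subset_left

theorem closure_cap_subset : closure (cap Ω ν κ) ⊆ {x | inner ℝ x ν ≤ κ} :=
  closure_minimal (fun x hx => le_of_lt (show inner ℝ x ν < κ from hx.2)) (isClosed_le (by fun_prop) continuous_const)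

/-- The difference of `f` at the reflected point and at the point. -/
def reflectionDiff (ν : E n) (κ : ℝ) (f : E n → ℝ) (x : E n) : ℝ :=
  f (planeReflection ν κ x) - f x

theorem reflectionDiff_planeReflection (hν : ‖ν‖ = 1) (f : E n → ℝ) (x : E n) :
    reflectionDiff ν κ f (planeReflection ν κ x) = -reflectionDiff ν κ f x := by
  rw [reflectionDiff, planeReflection_planeReflection hν, reflectionDiff, neg_sub]

theorem continuous_reflectionDiff (hν : ‖ν‖ = 1) {f : E n → ℝ} (hf : Continuous f) :
    Continuous (reflectionDiff ν κ f) :=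
  (hf.comp (continuous_planeReflection hν κ)).sub hf

theorem abs_reflectionDiff_le {f : E n → ℝ} {M : ℝ} (hM : ∀ x, |f x| ≤ M) (x : E n) :
    |reflectionDiff ν κ f x| ≤ 2 * M := by
  have h1 := abs_le.mp (hM (planeReflection ν κ x))
  have h2 := abs_le.mp (hM x)
  rw [reflectionDiff, abs_le]
  constructor <;> linarith

/-- Supplies the boundary and exterior sign for all the minimum principles: off `Ω` only the
reflected value survives, and on the hyperplane the difference is zero. -/
theorem reflectionDiff_nonneg_of_not_mem_cap {f : E n → ℝ} (hf : ∀ x, 0 ≤ f x)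
    (hf0 : ∀ x ∉ Ω, f x = 0) {x : E n} (hx : inner ℝ x ν ≤ κ) (hxc : x ∉ cap Ω ν κ) :
    0 ≤ reflectionDiff ν κ f x := by
  by_cases hxΩ : x ∈ Ω
  · have h1 : inner ℝ x ν = κ := le_antisymm hx (not_lt.mp fun h => hxc ⟨hxΩ, h⟩)
    simp [reflectionDiff, planeReflection, h1]
  · rw [reflectionDiff, hf0 x hxΩ, sub_zero]
    exact hf _

/-- At a nonpositive minimum over the half-space, located in a cap, of an antisymmetric function,
the half-Laplacian is at most a fixed multiple of the minimum. -/
theorem exists_forall_le_mul_antisymmetric_min (hn : 0 < n) (hΩb : Bornology.IsBounded Ω)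
    (hR : ReflectsCaps Ω x₀ ν κ₁) :
    ∃ θ : ℝ, 0 < θ ∧ ∀ κ ≤ κ₁, ∀ (w : E n → ℝ), Continuous w → ∀ M : ℝ, (∀ y, |w y| ≤ M) →
      (∀ y, w (planeReflection ν κ y) = -w y) → ∀ x ∈ cap Ω ν κ, w x ≤ 0 →
      (∀ y, inner ℝ y ν ≤ κ → w x ≤ w y) → ∀ L : ℝ,
      Filter.Tendsto (fun δ : ℝ => fracConst n (1 / 2) * ∫ y in (Metric.ball x δ)ᶜ,
        (w x - w y) / ‖x - y‖ ^ ((n : ℝ) + 2 * (1 / 2))) (𝓝[>] 0) (𝓝 L) →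
      L ≤ θ * w x := by
  have hν := hR.norm_eq_one
  obtain ⟨ρ, hρ⟩ := hΩb.exists_norm_le
  set c := inner ℝ x₀ ν with hc
  -- A unit ball strictly below `Ω`, at distance at least `2` from every point of every cap. There
  -- the folded integrand is at most `2 w x / B ^ s`, where `B` bounds `‖x - R y‖` uniformly in `κ ≤
  -- κ₁`; hence `θ` is independent of `κ` and `w`.
  set A : Set (E n) := Metric.ball (x₀ - (3 : ℝ) • ν) 1 with hA
  set s : ℝ := (n : ℝ) + 2 * (1 / 2) with hs
  have hs0 : 0 < s := by rw [hs]; positivity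
  set B : ℝ := |ρ| + (‖x₀‖ + 4) + 2 * (|κ₁ - c| + 4) with hB
  have hB0 : 0 < B := by positivity
  have hvol : 0 < volume.real A :=
    ENNReal.toReal_pos (Metric.measure_ball_pos _ _ one_pos).ne' measure_ball_lt_top.ne
  have hAy : ∀ y ∈ A, c - 4 < inner ℝ y ν ∧ inner ℝ y ν < c - 2 ∧ ‖y‖ ≤ ‖x₀‖ + 4 := by
    intro y hy
    rw [hA, Metric.mem_ball, dist_eq_norm] at hy
    have h1 : |inner ℝ (y - (x₀ - (3 : ℝ) • ν)) ν| ≤ ‖y - (x₀ - (3 : ℝ) • ν)‖ := by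
      simpa [hν] using abs_real_inner_le_norm (y - (x₀ - (3 : ℝ) • ν)) ν
    have h2 : inner ℝ (y - (x₀ - (3 : ℝ) • ν)) ν = inner ℝ y ν - c + 3 := by
      rw [inner_sub_left, inner_sub_left, real_inner_smul_left, real_inner_self_eq_norm_sq, hν]
      ring
    rw [h2] at h1
    have h3 := abs_le.mp h1
    refine ⟨by linarith, by linarith, ?_⟩
    have h4 : ‖y‖ ≤ ‖y - (x₀ - (3 : ℝ) • ν)‖ + ‖x₀ - (3 : ℝ) • ν‖ := by
      simpa using norm_add_le (y - (x₀ - (3 : ℝ) • ν)) (x₀ - (3 : ℝ) • ν)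
    have h5 : ‖x₀ - (3 : ℝ) • ν‖ ≤ ‖x₀‖ + 3 := by
      refine (norm_sub_le _ _).trans ?_
      rw [norm_smul, hν]; norm_num
    linarith
  refine ⟨fracConst n (1 / 2) * (2 * (B ^ s)⁻¹ * volume.real A), ?_, ?_⟩
  · have := fracConst_half_pos hn
    positivity
  intro κ hκ w hw M hM hanti x hx hx0 hmin L hL
  have hcx : c ≤ inner ℝ x ν := hR.inner_le x (subset_closure hx.1)
  have hxκ : inner ℝ x ν < κ := hx.2
  have hdist : ∀ y ∈ A, 2 ≤ ‖x - y‖ := by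
    intro y hy
    obtain ⟨-, h2, -⟩ := hAy y hy
    have h1 : inner ℝ (x - y) ν ≤ ‖x - y‖ := by
      simpa [hν] using real_inner_le_norm (x - y) ν
    rw [inner_sub_left] at h1
    linarith
  have hmain := le_of_antisymmetric_min hn hν hw hM hanti hxκ hx0 hmin hL
    (A := A) Metric.isOpen_ball.measurableSet
    (fun y hy => by linarith [(hAy y hy).2.1]) (r := 1) one_pos ?_ measure_ball_lt_top.ne
    (t := 2 * w x * (B ^ s)⁻¹) ?_
  · calc L ≤ _ := hmain
      _ = _ := by ring
  · rw [Set.disjoint_left]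
    intro y hy hyb
    rw [Metric.mem_ball, dist_comm, dist_eq_norm] at hyb
    linarith [hdist y hy]
  · intro y hy
    obtain ⟨h1, h2, h3⟩ := hAy y hy
    have hyκ : inner ℝ y ν ≤ κ := by linarith
    have h4 : ‖x - y‖ ≤ ‖x - planeReflection ν κ y‖ :=
      norm_sub_le_norm_sub_planeReflection hν hxκ.le hyκ
    have h5 : 0 < ‖x - y‖ := lt_of_lt_of_le two_pos (hdist y hy)
    have h6 : ‖x - planeReflection ν κ y‖ ≤ B := by
      have e1 : ‖planeReflection ν κ y‖ ≤ ‖y‖ + 2 * (κ - inner ℝ y ν) := by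
        rw [planeReflection]
        refine (norm_add_le _ _).trans ?_
        rw [norm_smul, hν, Real.norm_of_nonneg (by linarith), mul_one]
      have e2 := norm_sub_le x (planeReflection ν κ y)
      have e3 : ‖x‖ ≤ |ρ| := (hρ x hx.1).trans (le_abs_self _)
      have e4 := le_abs_self (κ₁ - c)
      rw [hB]
      linarith
    have h7 : (B ^ s)⁻¹ ≤ (‖x - planeReflection ν κ y‖ ^ s)⁻¹ := by
      have : 0 < ‖x - planeReflection ν κ y‖ := h5.trans_le h4
      gcongr
    have h8 : (‖x - planeReflection ν κ y‖ ^ s)⁻¹ ≤ (‖x - y‖ ^ s)⁻¹ := by gcongr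
    have h9 : w x - w y ≤ 0 := sub_nonpos.mpr (hmin y hyκ)
    rw [← hs, div_eq_mul_inv, div_eq_mul_inv]
    nlinarith [mul_nonneg (neg_nonneg.mpr h9) (sub_nonneg.mpr h8),
      mul_nonneg (neg_nonneg.mpr hx0) (sub_nonneg.mpr h7)]

variable {m : ℕ} {U : ℕ → E n → ℝ} {g : E n → ℝ}

theorem IsNavierChain.tendsto_reflectionDiff (h : IsNavierChain Ω m U g)
    (hΩb : Bornology.IsBounded Ω) (hR : ReflectsCaps Ω x₀ ν κ₁) (hκ : κ ≤ κ₁) {x : E n}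
    (hx : x ∈ cap Ω ν κ) :
    Filter.Tendsto (fun δ : ℝ => fracConst n (1 / 2) * ∫ y in (Metric.ball x δ)ᶜ,
        (reflectionDiff ν κ (U m) x - reflectionDiff ν κ (U m) y)
          / ‖x - y‖ ^ ((n : ℝ) + 2 * (1 / 2)))
      (𝓝[>] 0) (𝓝 (reflectionDiff ν κ g x)) := by
  obtain ⟨M, -, hM⟩ := h.exists_bound hΩb le_rfl
  exact HasFracLaplacianAt.tendsto_reflection_sub hR.norm_eq_one (h.continuous m le_rfl) hM
    (h.frac _ (hR.reflection_mem κ hκ x (subset_closure hx.1) hx.2)) (h.frac x hx.1)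

/-- Lower bound for the reflected difference of the top function of a chain. -/
theorem exists_forall_neg_le_reflectionDiff_top (hn : 0 < n) (hΩb : Bornology.IsBounded Ω)
    (hR : ReflectsCaps Ω x₀ ν κ₁) :
    ∃ θ : ℝ, 0 < θ ∧ ∀ (m : ℕ) (U : ℕ → E n → ℝ) (g : E n → ℝ), IsNavierChain Ω m U g →
      (∀ x ∈ Ω, 0 < g x) → ∀ κ ≤ κ₁, ∀ a : ℝ, 0 ≤ a →
      (∀ x ∈ cap Ω ν κ, -a ≤ reflectionDiff ν κ g x) →
      ∀ x ∈ cap Ω ν κ, -(a / θ) ≤ reflectionDiff ν κ (U m) x := by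
  obtain ⟨θ, hθ, hmain⟩ := exists_forall_le_mul_antisymmetric_min hn hΩb hR
  refine ⟨θ, hθ, fun m U g h hg κ hκ a ha hga x hx => ?_⟩
  by_contra! hlt
  have hν := hR.norm_eq_one
  obtain ⟨M, -, hM⟩ := h.exists_bound hΩb (i := m) le_rfl
  have hle : reflectionDiff ν κ (U m) x ≤ 0 := by
    have : 0 ≤ a / θ := by positivity
    linarith
  obtain ⟨y, hy, hyx, hymin⟩ := exists_min_of_nonpos (isBounded_cap hΩb) closure_cap_subset
    (continuous_reflectionDiff hν (h.continuous m le_rfl))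
    (fun z hz hzc => reflectionDiff_nonneg_of_not_mem_cap (h.nonneg hn hΩb hg le_rfl)
      (h.eq_zero m le_rfl) hz hzc) hx hle
  have h1 := hmain κ hκ _ (continuous_reflectionDiff hν (h.continuous m le_rfl)) (2 * M)
    (abs_reflectionDiff_le hM) (reflectionDiff_planeReflection hν _) y hy (hyx.trans hle)
    hymin _ (h.tendsto_reflectionDiff hΩb hR hκ hy)
  have h2 := hga y hy
  have h3 : θ * reflectionDiff ν κ (U m) y < θ * (-(a / θ)) :=
    mul_lt_mul_of_pos_left (lt_of_le_of_lt hyx hlt) hθ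
  have h4 : θ * (-(a / θ)) = -a := by field_simp
  linarith

theorem IsNavierChain.contDiffAt_reflectionDiff (h : IsNavierChain Ω m U g)
    (hR : ReflectsCaps Ω x₀ ν κ₁) (hκ : κ ≤ κ₁) {i : ℕ} (hi : i < m) {x : E n}
    (hx : x ∈ cap Ω ν κ) : ContDiffAt ℝ 2 (reflectionDiff ν κ (U i)) x :=
  ((h.contDiffAt i hi _ (hR.reflection_mem κ hκ x (subset_closure hx.1) hx.2)).comp x
    (contDiff_planeReflection ν κ).contDiffAt).sub (h.contDiffAt i hi x hx.1)

theorem IsNavierChain.laplacian_reflectionDiff (h : IsNavierChain Ω m U g)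
    (hR : ReflectsCaps Ω x₀ ν κ₁) (hκ : κ ≤ κ₁) {i : ℕ} (hi : i < m) {x : E n}
    (hx : x ∈ cap Ω ν κ) :
    Laplacian.laplacian (reflectionDiff ν κ (U i)) x = -reflectionDiff ν κ (U (i + 1)) x := by
  have hRx := hR.reflection_mem κ hκ x (subset_closure hx.1) hx.2
  have h1 : reflectionDiff ν κ (U i) = (fun y => U i (planeReflection ν κ y)) - U i := rfl
  have h2 : ContDiffAt ℝ 2 (fun y => U i (planeReflection ν κ y)) x :=
    (h.contDiffAt i hi _ hRx).comp x (contDiff_planeReflection ν κ).contDiffAt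
  rw [h1, h2.laplacian_sub (h.contDiffAt i hi x hx.1),
    laplacian_comp_planeReflection hR.norm_eq_one, h.laplacian i hi _ hRx,
    h.laplacian i hi x hx.1, reflectionDiff]
  ring

theorem IsNavierChain.neg_mul_sq_le_reflectionDiff (h : IsNavierChain Ω m U g) (hn : 0 < n)
    (hΩo : IsOpen Ω) (hΩc : Convex ℝ Ω) (hΩb : Bornology.IsBounded Ω)
    (hg : ∀ x ∈ Ω, 0 < g x) (hR : ReflectsCaps Ω x₀ ν κ₁) (hκ : κ ≤ κ₁) {i : ℕ} (hi : i < m)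
    {a ε : ℝ} (ha : 0 ≤ a) (hε : 0 < ε)
    (hw : ∀ x ∈ cap Ω ν κ, -a ≤ reflectionDiff ν κ (U (i + 1)) x)
    (hnarrow : ∀ x ∈ cap Ω ν κ, reflectionDiff ν κ (U i) x < 0 →
      ∃ z ∉ cap Ω ν κ, ‖x - z‖ < ε) :
    ∀ x ∈ cap Ω ν κ, -(a * ε ^ 2) ≤ reflectionDiff ν κ (U i) x := by
  refine neg_mul_sq_le_of_narrow (isOpen_cap hΩo) (convex_cap hΩc) (isBounded_cap hΩb) ha hε
    (continuous_reflectionDiff hR.norm_eq_one (h.continuous i hi.le)).continuousOn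
    (fun x hx => h.contDiffAt_reflectionDiff hR hκ hi hx) (fun x hx => ?_) (fun x hx => ?_) hnarrow
  · rw [(isOpen_cap hΩo).frontier_eq] at hx
    exact reflectionDiff_nonneg_of_not_mem_cap (h.nonneg hn hΩb hg hi.le) (h.eq_zero i hi.le)
      (closure_cap_subset hx.1) hx.2
  · rw [h.laplacian_reflectionDiff hR hκ hi hx]
    linarith [hw x hx]

/-- Without narrowness the minimum principle still applies with the crude width `ρ`, costing `ρ ^ 2`
for each level descended. -/
theorem IsNavierChain.neg_mul_pow_le_reflectionDiff (h : IsNavierChain Ω m U g) (hn : 0 < n)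
    (hΩo : IsOpen Ω) (hΩc : Convex ℝ Ω) (hΩb : Bornology.IsBounded Ω)
    (hg : ∀ x ∈ Ω, 0 < g x) (hR : ReflectsCaps Ω x₀ ν κ₁) (hκ : κ ≤ κ₁)
    {a ρ : ℝ} (ha : 0 ≤ a) (hρ : 0 < ρ) (hΩρ : ∀ x ∈ Ω, ∃ z ∉ Ω, ‖x - z‖ < ρ)
    (hw : ∀ x ∈ cap Ω ν κ, -a ≤ reflectionDiff ν κ (U m) x) {i : ℕ} (hi : i ≤ m) :
    ∀ x ∈ cap Ω ν κ, -(a * (ρ ^ 2) ^ (m - i)) ≤ reflectionDiff ν κ (U i) x := by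
  induction hi using Nat.decreasingInduction with
  | self => simpa using hw
  | of_succ k hk ih =>
    have h1 : m - k = m - (k + 1) + 1 := by omega
    rw [h1, pow_succ, ← mul_assoc]
    refine h.neg_mul_sq_le_reflectionDiff hn hΩo hΩc hΩb hg hR hκ hk (by positivity) hρ ih ?_
    intro x hx _
    obtain ⟨z, hz, hxz⟩ := hΩρ x hx.1
    exact ⟨z, fun h => hz h.1, hxz⟩

theorem IsNavierChain.reflectionDiff_nonneg (h : IsNavierChain Ω m U g) (hn : 0 < n)
    (hΩo : IsOpen Ω) (hΩc : Convex ℝ Ω) (hΩb : Bornology.IsBounded Ω)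
    (hg : ∀ x ∈ Ω, 0 < g x) (hR : ReflectsCaps Ω x₀ ν κ₁) (hκ : κ ≤ κ₁)
    (hw : ∀ x ∈ cap Ω ν κ, 0 ≤ reflectionDiff ν κ g x) {i : ℕ} (hi : i ≤ m) :
    ∀ x ∈ cap Ω ν κ, 0 ≤ reflectionDiff ν κ (U i) x := by
  obtain ⟨θ, hθ, hmain⟩ := exists_forall_neg_le_reflectionDiff_top hn hΩb hR
  obtain ⟨ρ, hρ⟩ := hΩb.exists_norm_le
  have h1 := hmain m U g h hg κ hκ 0 le_rfl (by simpa using hw)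
  have hΩρ : ∀ x ∈ Ω, ∃ z ∉ Ω, ‖x - z‖ < |ρ| + ‖x₀‖ + 1 := fun x hx => by
    refine ⟨x₀, hR.not_mem, ?_⟩
    linarith [norm_sub_le x x₀, hρ x hx, le_abs_self ρ]
  have h2 := h.neg_mul_pow_le_reflectionDiff hn hΩo hΩc hΩb hg hR hκ (a := 0) le_rfl
    (by positivity) hΩρ (by simpa using h1) hi
  simpa using h2

/-- Strong minimum principle for the reflected differences. -/
theorem IsNavierChain.reflectionDiff_pos (h : IsNavierChain Ω m U g) (hn : 0 < n)
    (hΩo : IsOpen Ω) (hΩc : Convex ℝ Ω) (hΩb : Bornology.IsBounded Ω)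
    (hg : ∀ x ∈ Ω, 0 < g x) (hR : ReflectsCaps Ω x₀ ν κ₁) (hκ : κ ≤ κ₁)
    (hw : ∀ x ∈ cap Ω ν κ, 0 ≤ reflectionDiff ν κ g x) {i : ℕ} (hi : i ≤ m) :
    ∀ x ∈ cap Ω ν κ, 0 < reflectionDiff ν κ (U i) x := by
  have hν := hR.norm_eq_one
  have hnn : ∀ j ≤ m, ∀ x ∈ cap Ω ν κ, 0 ≤ reflectionDiff ν κ (U j) x := fun j hj =>
    h.reflectionDiff_nonneg hn hΩo hΩc hΩb hg hR hκ hw hj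
  induction hi using Nat.decreasingInduction with
  | self =>
    intro x hx
    refine lt_of_le_of_ne (hnn m le_rfl x hx) fun h0 => ?_
    set w := reflectionDiff ν κ (U m) with hwdef
    have hwc : Continuous w := continuous_reflectionDiff hν (h.continuous m le_rfl)
    obtain ⟨M, -, hM⟩ := h.exists_bound hΩb (i := m) le_rfl
    have hmin : ∀ y, inner ℝ y ν ≤ κ → w x ≤ w y := fun y hy => by
      rw [← h0]
      by_cases hyc : y ∈ cap Ω ν κ
      · exact hnn m le_rfl y hyc
      · exact reflectionDiff_nonneg_of_not_mem_cap (h.nonneg hn hΩb hg le_rfl)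
          (h.eq_zero m le_rfl) hy hyc
    have hxκ : inner ℝ x ν < κ := hx.2
    have hx₀κ : inner ℝ x₀ ν < κ := lt_of_le_of_lt (hR.inner_le x (subset_closure hx.1)) hxκ
    have hne : x ≠ x₀ := fun he => hR.not_mem (he ▸ hx.1)
    -- An antisymmetric function vanishing at an interior minimum is excluded by one point of
    -- positivity: `x₀` lies off `Ω`, while its reflection lies in `Ω`.
    have hwx₀ : 0 < w x₀ := by
      rw [hwdef, reflectionDiff, h.eq_zero m le_rfl x₀ hR.not_mem, sub_zero]
      exact h.pos hn hΩb hg le_rfl _ (hR.reflection_mem κ hκ x₀ hR.mem_closure hx₀κ)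
    set s : ℝ := (n : ℝ) + 2 * (1 / 2) with hs
    have hs0 : 0 < s := by rw [hs]; positivity
    set G : E n → ℝ := fun y => (w x - w y) / ‖x - y‖ ^ s +
      (w x + w y) / ‖x - planeReflection ν κ y‖ ^ s with hG
    have hd1 : 0 < ‖x - x₀‖ := norm_pos_iff.mpr (sub_ne_zero.mpr hne)
    have hd2 : ‖x - x₀‖ < ‖x - planeReflection ν κ x₀‖ :=
      norm_sub_lt_norm_sub_planeReflection hν hxκ hx₀κ
    -- As `w x = 0`, `G x₀` is `w x₀` times a negative difference of kernels. By continuity `G`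
    -- stays below `G x₀ / 2` near `x₀`, which makes the half-Laplacian difference at `x` negative,
    -- against `hw`.
    have hGx₀ : G x₀ < 0 := by
      have h1 : (‖x - planeReflection ν κ x₀‖ ^ s)⁻¹ < (‖x - x₀‖ ^ s)⁻¹ := by gcongr
      simp only [hG, ← h0, div_eq_mul_inv]
      nlinarith [mul_pos hwx₀ (sub_pos.mpr h1)]
    have hGc : ContinuousAt G x₀ := by
      have hRc := (continuous_planeReflection hν κ).continuousAt (x := x₀)
      refine ContinuousAt.add (ContinuousAt.div (continuousAt_const.sub hwc.continuousAt) ?_ ?_)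
        (ContinuousAt.div (continuousAt_const.add hwc.continuousAt) ?_ ?_)
      · exact (continuousAt_const.sub continuousAt_id).norm.rpow_const (Or.inr hs0.le)
      · positivity
      · exact (continuousAt_const.sub hRc).norm.rpow_const (Or.inr hs0.le)
      · have := hd1.trans hd2
        positivity
    have hev : ∀ᶠ y in 𝓝 x₀, G y < G x₀ / 2 ∧ inner ℝ y ν < κ ∧ ‖x - x₀‖ / 2 < dist y x := by
      refine (hGc.eventually_lt continuousAt_const (by linarith)).and (Filter.Eventually.and ?_ ?_)
      · exact (isOpen_lt (f := fun y : E n => (inner ℝ y ν : ℝ)) (by fun_prop)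
          continuous_const).mem_nhds hx₀κ
      · refine (isOpen_lt (f := fun _ : E n => ‖x - x₀‖ / 2) continuous_const
          (by fun_prop)).mem_nhds ?_
        show ‖x - x₀‖ / 2 < dist x₀ x
        rw [dist_comm, dist_eq_norm]
        linarith
    obtain ⟨r, hr, hball⟩ := Metric.eventually_nhds_iff_ball.mp hev
    have hmain := le_of_antisymmetric_min hn hν hwc (abs_reflectionDiff_le hM)
      (reflectionDiff_planeReflection hν _) hxκ h0.ge hmin
      (h.tendsto_reflectionDiff hΩb hR hκ hx) (A := Metric.ball x₀ r)
      Metric.isOpen_ball.measurableSet (fun y hy => (hball y hy).2.1) (half_pos hd1)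
      (Set.disjoint_left.mpr fun y hy hyb => absurd (hball y hy).2.2
        (not_lt.mpr (Metric.mem_ball.mp hyb).le))
      measure_ball_lt_top.ne (t := G x₀ / 2) (fun y hy => (hball y hy).1.le)
    have hvol : 0 < volume.real (Metric.ball x₀ r) :=
      ENNReal.toReal_pos (Metric.measure_ball_pos _ _ hr).ne' measure_ball_lt_top.ne
    have h1 : G x₀ / 2 * volume.real (Metric.ball x₀ r) < 0 :=
      mul_neg_of_neg_of_pos (by linarith) hvol
    have h2 := mul_neg_of_pos_of_neg (fracConst_half_pos hn) h1
    linarith [hw x hx]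
  | of_succ k hk ih =>
    intro x hx
    refine lt_of_le_of_ne (hnn k hk.le x hx) fun h0 => ?_
    have hloc : IsLocalMin (reflectionDiff ν κ (U k)) x := by
      filter_upwards [(isOpen_cap hΩo).mem_nhds hx] with y hy
      rw [← h0]
      exact hnn k hk.le y hy
    have h1 := laplacian_nonneg_of_isLocalMin (h.contDiffAt_reflectionDiff hR hκ hk hx) hloc
    rw [h.laplacian_reflectionDiff hR hκ hk hx] at h1
    linarith [ih x hx]

end Caps

/-! ### Geometry of small caps -/

section Geometry

variable {n : ℕ} {Ω U : Set (E n)} {x₀ ν : E n} {ρ : E n → ℝ}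

theorem IsLocalDefiningFunction.nonneg_of_mem_closure (h : IsLocalDefiningFunction Ω x₀ U ρ)
    (hΩo : IsOpen Ω) {x : E n} (hxU : x ∈ U) (hx : x ∈ closure Ω) : 0 ≤ ρ x := by
  by_cases hxΩ : x ∈ Ω
  · exact ((h.mem_domain_iff x hxU).mp hxΩ).le
  · refine ((h.mem_frontier_iff x hxU).mp ?_).ge
    rw [hΩo.frontier_eq]
    exact ⟨hx, hxΩ⟩

theorem IsLocalDefiningFunction.contDiffAt (h : IsLocalDefiningFunction Ω x₀ U ρ) {x : E n}
    (hx : x ∈ U) : ContDiffAt ℝ ∞ ρ x :=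
  h.smooth.contDiffAt (h.isOpen.mem_nhds hx)

/-- Along the segment from `x₀` to `y`, which stays in `closure Ω`, `ρ` starts at `0` and is
nonnegative near `x₀`, so its one-sided derivative there is nonnegative. -/
theorem IsLocalDefiningFunction.inner_gradient_nonneg (h : IsLocalDefiningFunction Ω x₀ U ρ)
    (hΩo : IsOpen Ω) (hΩc : Convex ℝ Ω) (hx₀ : x₀ ∈ frontier Ω) {y : E n} (hy : y ∈ closure Ω) :
    0 ≤ inner ℝ (gradient ρ x₀) (y - x₀) := by
  have hd : DifferentiableAt ℝ ρ x₀ := (h.contDiffAt h.mem).differentiableAt (by simp)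
  set l : ℝ → E n := fun t => x₀ + t • (y - x₀) with hl
  have hl0 : l 0 = x₀ := by simp [hl]
  have hld : HasDerivAt l (y - x₀) 0 := by
    simpa [hl] using ((hasDerivAt_id (0 : ℝ)).smul_const (y - x₀)).const_add x₀
  have hderiv : HasDerivAt (ρ ∘ l) (inner ℝ (gradient ρ x₀) (y - x₀)) 0 := by
    have h1 : HasFDerivAt ρ (fderiv ℝ ρ x₀) (l 0) := by rw [hl0]; exact hd.hasFDerivAt
    have h2 := h1.comp_hasDerivAt 0 hld
    have h3 : inner ℝ (gradient ρ x₀) (y - x₀) = fderiv ℝ ρ x₀ (y - x₀) :=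
      InnerProductSpace.toDual_symm_apply
    rwa [h3]
  have hρ0 : ρ x₀ = 0 := (h.mem_frontier_iff x₀ h.mem).mp hx₀
  have htend := hderiv.tendsto_slope.mono_left
    (nhdsWithin_mono (0 : ℝ) (fun t (ht : 0 < t) => ht.ne') :
      𝓝[>] (0 : ℝ) ≤ 𝓝[≠] 0)
  refine ge_of_tendsto htend ?_
  have hU : ∀ᶠ t in 𝓝[>] (0 : ℝ), l t ∈ U :=
    nhdsWithin_le_nhds (hld.continuousAt.eventually
      (by rw [hl0]; exact h.isOpen.mem_nhds h.mem))
  filter_upwards [hU, self_mem_nhdsWithin, nhdsWithin_le_nhds (Iio_mem_nhds one_pos)]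
    with t htU (ht0 : 0 < t) (ht1 : t < 1)
  have hmem : l t ∈ closure Ω :=
    hΩc.closure.add_smul_sub_mem hx₀.1 hy ⟨ht0.le, ht1.le⟩
  have h4 := h.nonneg_of_mem_closure hΩo htU hmem
  rw [slope_def_field]
  simp only [Function.comp_apply, hl0, hρ0, sub_zero]
  positivity

/-- The part of a compact set close to a strict minimum in height lies near the minimum point. -/
theorem exists_forall_inner_le_imp_norm_sub_lt {K : Set (E n)} (hK : IsCompact K)
    (hmin : ∀ y ∈ K, y ≠ x₀ → inner ℝ x₀ ν < inner ℝ y ν) {r : ℝ} (hr : 0 < r) :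
    ∃ η > 0, ∀ x ∈ K, inner ℝ x ν ≤ inner ℝ x₀ ν + η → ‖x - x₀‖ < r := by
  have hK' : IsCompact (K \ Metric.ball x₀ r) := hK.diff Metric.isOpen_ball
  rcases (K \ Metric.ball x₀ r).eq_empty_or_nonempty with he | hne
  · refine ⟨1, one_pos, fun x hx _ => ?_⟩
    by_contra hcon
    have : x ∈ K \ Metric.ball x₀ r := ⟨hx, by rwa [Metric.mem_ball, dist_eq_norm]⟩
    rw [he] at this
    exact this
  · obtain ⟨y, hy, hymin⟩ := hK'.exists_isMinOn (f := fun y => inner ℝ y ν) hne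
      (by fun_prop)
    have hyx : y ≠ x₀ := fun he => hy.2 (he ▸ Metric.mem_ball_self hr)
    have hlt := hmin y hy.1 hyx
    refine ⟨(inner ℝ y ν - inner ℝ x₀ ν) / 2, by linarith, fun x hx hxη => ?_⟩
    by_contra hcon
    have h1 : inner ℝ y ν ≤ inner ℝ x ν :=
      hymin ⟨hx, by rwa [Metric.mem_ball, dist_eq_norm]⟩
    linarith

/-- Strict convexity makes `x₀` the only lowest point, so low caps lie near it. There `ρ` is
strictly increasing along `ν`, so moving a point of the closed cap up to its mirror image ends in
`Ω`. -/
theorem exists_reflectsCaps (hΩ : IsSmoothStrictlyConvexDomain Ω) (hx₀ : x₀ ∈ frontier Ω)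
    (hν : IsUnitInwardNormal Ω x₀ ν) :
    ∃ δ₀ : ℝ, 0 < δ₀ ∧ ReflectsCaps Ω x₀ ν (inner ℝ x₀ ν + δ₀) := by
  obtain ⟨U, ρ, h, hνeq⟩ := hν
  have hg : 0 < ‖gradient ρ x₀‖ := norm_pos_iff.mpr h.gradient_ne_zero
  have hν1 : ‖ν‖ = 1 := by
    rw [hνeq, norm_smul, norm_inv, norm_norm, inv_mul_cancel₀ hg.ne']
  have hx₀Ω : x₀ ∉ Ω := by
    have h1 := hx₀
    rw [hΩ.isOpen.frontier_eq] at h1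
    exact h1.2
  have hle : ∀ x ∈ closure Ω, inner ℝ x₀ ν ≤ inner ℝ x ν := by
    intro x hx
    have h1 := h.inner_gradient_nonneg hΩ.isOpen hΩ.convex hx₀ hx
    have h2 : 0 ≤ inner ℝ (x - x₀) ν := by
      rw [hνeq, real_inner_smul_right, real_inner_comm]
      positivity
    rw [inner_sub_left] at h2
    linarith
  have hstrict : ∀ y ∈ closure Ω, y ≠ x₀ → inner ℝ x₀ ν < inner ℝ y ν := by
    intro y hy hne
    refine lt_of_le_of_ne (hle y hy) fun heq => ?_
    -- With a second lowest point, the midpoint would be interior, and moving down from it would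
    -- leave the supporting half-space inside `closure Ω`.
    have hmid := hΩ.strictConvex_closure hx₀.1 hy hne.symm (a := 1 / 2) (b := 1 / 2)
      (by norm_num) (by norm_num) (by norm_num)
    set z := (1 / 2 : ℝ) • x₀ + (1 / 2 : ℝ) • y with hz
    have hzν : inner ℝ z ν = inner ℝ x₀ ν := by
      rw [hz, inner_add_left, real_inner_smul_left, real_inner_smul_left, ← heq]
      ring
    obtain ⟨r, hr, hball⟩ := Metric.mem_nhds_iff.mp (mem_interior_iff_mem_nhds.mp hmid)
    have h1 : z - (r / 2) • ν ∈ closure Ω := by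
      refine hball ?_
      rw [Metric.mem_ball, dist_eq_norm]
      have : z - (r / 2) • ν - z = -((r / 2) • ν) := by abel
      rw [this, norm_neg, norm_smul, hν1, Real.norm_of_nonneg (by positivity)]
      linarith
    have h2 := hle _ h1
    rw [inner_sub_left, real_inner_smul_left, real_inner_self_eq_norm_sq, hν1, hzν] at h2
    linarith
  have hpos : 0 < fderiv ℝ ρ x₀ ν := by
    have h3 : inner ℝ (gradient ρ x₀) ν = fderiv ℝ ρ x₀ ν :=
      InnerProductSpace.toDual_symm_apply
    rw [← h3, hνeq, real_inner_smul_right, real_inner_self_eq_norm_sq]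
    positivity
  have hev : ∀ᶠ x in 𝓝 x₀, x ∈ U ∧ 0 < fderiv ℝ ρ x ν := by
    refine Filter.Eventually.and (h.isOpen.mem_nhds h.mem) ?_
    have hc : ContinuousAt (fun x => fderiv ℝ ρ x ν) x₀ :=
      ((h.contDiffAt h.mem).fderiv_right (m := 0) (by simp)).continuousAt.clm_apply
        continuousAt_const
    exact continuousAt_const.eventually_lt hc hpos
  obtain ⟨r, hr, hball⟩ := Metric.eventually_nhds_iff_ball.mp hev
  obtain ⟨η, hη, hcap⟩ := exists_forall_inner_le_imp_norm_sub_lt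
    hΩ.bounded.isCompact_closure hstrict (half_pos hr)
  -- `η` puts the cap within `r / 2` of `x₀`; `r / 8` limits the displacement `T` to `r / 4`, so the
  -- segment to the mirror image stays in the ball of radius `r`.
  refine ⟨min η (r / 8), by positivity, hν1, hx₀.1, hx₀Ω, hle, fun κ hκ x hx hxκ => ?_⟩
  have hδη : κ ≤ inner ℝ x₀ ν + η := hκ.trans (by gcongr; exact min_le_left _ _)
  have hδr : κ ≤ inner ℝ x₀ ν + r / 8 := hκ.trans (by gcongr; exact min_le_right _ _)
  have hxr : ‖x - x₀‖ < r / 2 := hcap x hx (by linarith)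
  have hxle := hle x hx
  set T := 2 * (κ - inner ℝ x ν) with hT
  have hT0 : 0 < T := by rw [hT]; linarith
  have hTr : T < r / 2 := by rw [hT]; linarith
  have hseg : ∀ t ∈ Set.Icc 0 T, x + t • ν ∈ Metric.ball x₀ r := by
    intro t ht
    rw [Metric.mem_ball, dist_eq_norm]
    have h1 : x + t • ν - x₀ = (x - x₀) + t • ν := by abel
    have h2 := norm_add_le (x - x₀) (t • ν)
    rw [norm_smul, hν1, Real.norm_of_nonneg ht.1, mul_one] at h2
    rw [h1]
    linarith [ht.2]
  have hderiv : ∀ t ∈ Set.Icc 0 T,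
      HasDerivAt (fun t : ℝ => ρ (x + t • ν)) (fderiv ℝ ρ (x + t • ν) ν) t := by
    intro t ht
    have h1 : HasDerivAt (fun t : ℝ => x + t • ν) ν t := by
      simpa using ((hasDerivAt_id t).smul_const ν).const_add x
    have h2 : DifferentiableAt ℝ ρ (x + t • ν) :=
      (h.contDiffAt (hball _ (hseg t ht)).1).differentiableAt (by simp)
    exact h2.hasFDerivAt.comp_hasDerivAt t h1
  have hmono : StrictMonoOn (fun t : ℝ => ρ (x + t • ν)) (Set.Icc 0 T) := by
    refine strictMonoOn_of_deriv_pos (convex_Icc 0 T)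
      (fun t ht => (hderiv t ht).continuousAt.continuousWithinAt) fun t ht => ?_
    have ht' := interior_subset ht
    rw [(hderiv t ht').deriv]
    exact (hball _ (hseg t ht')).2
  have h0 : (0 : ℝ) ∈ Set.Icc 0 T := ⟨le_rfl, hT0.le⟩
  have hT' : T ∈ Set.Icc 0 T := ⟨hT0.le, le_rfl⟩
  have hlt : ρ (x + (0 : ℝ) • ν) < ρ (x + T • ν) := hmono h0 hT' hT0
  have hx0 : 0 ≤ ρ (x + (0 : ℝ) • ν) := by
    rw [zero_smul, add_zero]
    refine h.nonneg_of_mem_closure hΩ.isOpen ?_ hx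
    have := (hball _ (hseg 0 h0)).1
    rwa [zero_smul, add_zero] at this
  exact (h.mem_domain_iff _ (hball _ (hseg T hT')).1).mpr (by linarith)

end Geometry

/-! ### Moving planes -/

section MovingPlanes

variable {n : ℕ} {Ω : Set (E n)} {x₀ ν : E n} {κ κ₁ : ℝ}

/-- Only `t < s` matters, and then both lie in `[0, M]`, where `p ≥ 1` keeps the derivative of the
power bounded down to `0`. -/
theorem neg_mul_le_rpow_sub_rpow {p M a s t : ℝ} (hp : 1 ≤ p) (ha : 0 ≤ a) (hs : 0 ≤ s)
    (hsM : s ≤ M) (ht : 0 ≤ t) (h : -a ≤ t - s) :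
    -(p * M ^ (p - 1) * a) ≤ t ^ p - s ^ p := by
  have hM : 0 ≤ M := hs.trans hsM
  have hc : 0 ≤ p * M ^ (p - 1) := by positivity
  rcases le_total s t with hst | hst
  · have h1 : s ^ p ≤ t ^ p := Real.rpow_le_rpow hs hst (by linarith)
    nlinarith [mul_nonneg hc ha]
  · have hb : ∀ x ∈ Set.Icc 0 M, ‖p * x ^ (p - 1)‖ ≤ p * M ^ (p - 1) := by
      intro x hx
      have hx0 := hx.1
      rw [Real.norm_of_nonneg (by positivity)]
      have := Real.rpow_le_rpow hx.1 hx.2 (sub_nonneg.mpr hp)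
      gcongr
    have h1 := (convex_Icc (0 : ℝ) M).norm_image_sub_le_of_norm_hasDerivWithin_le
      (f := fun x => x ^ p) (f' := fun x => p * x ^ (p - 1))
      (fun x _ => (Real.hasDerivAt_rpow_const (Or.inr hp)).hasDerivWithinAt) hb
      ⟨ht, hst.trans hsM⟩ ⟨hs, hsM⟩
    rw [Real.norm_eq_abs, Real.norm_of_nonneg (sub_nonneg.mpr hst)] at h1
    have h2 := (le_abs_self _).trans h1
    have h3 : p * M ^ (p - 1) * (s - t) ≤ p * M ^ (p - 1) * a := by gcongr; linarith
    linarith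

/-- If two bounded functions have negative parts controlled by half of any common bound, they are
nonnegative. -/
theorem nonneg_of_forall_neg_le_half {D : Set (E n)} {f₁ f₂ : E n → ℝ} {N : ℝ} (hN : 0 ≤ N)
    (h₁ : ∀ x ∈ D, -N ≤ f₁ x) (h₂ : ∀ x ∈ D, -N ≤ f₂ x)
    (hstep : ∀ a, 0 ≤ a → (∀ x ∈ D, -a ≤ f₁ x ∧ -a ≤ f₂ x) →
      ∀ x ∈ D, -(a / 2) ≤ f₁ x ∧ -(a / 2) ≤ f₂ x) :
    ∀ x ∈ D, 0 ≤ f₁ x ∧ 0 ≤ f₂ x := by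
  have hk : ∀ k : ℕ, ∀ x ∈ D, -(N * (1 / 2) ^ k) ≤ f₁ x ∧ -(N * (1 / 2) ^ k) ≤ f₂ x := by
    intro k
    induction k with
    | zero => intro x hx; simpa using ⟨h₁ x hx, h₂ x hx⟩
    | succ k ih =>
      have h3 : N * (1 / 2) ^ (k + 1) = N * (1 / 2) ^ k / 2 := by ring
      rw [h3]
      exact hstep _ (by positivity) ih
  have hlim : Filter.Tendsto (fun k : ℕ => -(N * (1 / 2 : ℝ) ^ k)) Filter.atTop (𝓝 0) := by
    simpa using ((tendsto_pow_atTop_nhds_zero_of_lt_one (r := (1 / 2 : ℝ)) (by norm_num)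
      (by norm_num)).const_mul N).neg
  exact fun x hx => ⟨le_of_tendsto' hlim fun k => (hk k x hx).1,
    le_of_tendsto' hlim fun k => (hk k x hx).2⟩

theorem reflectionDiff_rpow_nonneg {f : E n → ℝ}
    (hf : ∀ x ∈ Ω, 0 < f x) {p : ℝ} (hp : 1 ≤ p)
    (h : ∀ x ∈ cap Ω ν κ, 0 ≤ reflectionDiff ν κ f x) :
    ∀ x ∈ cap Ω ν κ, 0 ≤ reflectionDiff ν κ (fun y => f y ^ p) x := fun x hx =>
  sub_nonneg.mpr (Real.rpow_le_rpow (hf x hx.1).le (sub_nonneg.mp (h x hx)) (by linarith))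

/-- The points of a slightly larger cap outside the inner part of a cap are close to the complement
of the larger cap. -/
theorem exists_not_mem_cap_near (hν : ‖ν‖ = 1) {κ' ε : ℝ} (hκ : κ ≤ κ') (hκ' : κ' < κ + ε / 2)
    {x z : E n} (hz : z ∉ cap Ω ν κ) (hxz : ‖x - z‖ < ε / 2) :
    ∃ z' ∉ cap Ω ν κ', ‖x - z'‖ < ε := by
  by_cases hzΩ : z ∈ Ω
  · have hzκ : κ ≤ inner ℝ z ν := not_lt.mp fun h => hz ⟨hzΩ, h⟩
    -- A point of `Ω` off the smaller cap has height at least `κ`; the shift lifts it to height at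
    -- least `κ'` and moves it by less than `ε / 2`.
    refine ⟨z + (κ' - κ) • ν, fun hmem => ?_, ?_⟩
    · have h1 : inner ℝ (z + (κ' - κ) • ν) ν < κ' := hmem.2
      rw [inner_add_left, real_inner_smul_left, real_inner_self_eq_norm_sq, hν] at h1
      linarith
    · have h1 : x - (z + (κ' - κ) • ν) = (x - z) - (κ' - κ) • ν := by abel
      have h2 := norm_sub_le (x - z) ((κ' - κ) • ν)
      rw [norm_smul, hν, Real.norm_of_nonneg (sub_nonneg.mpr hκ)] at h2
      rw [h1]
      linarith
  · exact ⟨z, fun h => hzΩ h.1, by linarith [norm_nonneg (x - z)]⟩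

/-- The points at distance at least `ε` from the complement of a bounded set form a compact set. -/
theorem isCompact_forall_le_norm_sub {D : Set (E n)} (hDb : Bornology.IsBounded D) {ε : ℝ}
    (hε : 0 < ε) : IsCompact {x : E n | ∀ z ∉ D, ε ≤ ‖x - z‖} := by
  refine Metric.isCompact_of_isClosed_isBounded ?_ (hDb.subset fun x hx => ?_)
  · simp only [Set.ofPred_forall]
    exact isClosed_iInter fun z => isClosed_iInter fun _ =>
      isClosed_le continuous_const (by fun_prop)
  · by_contra hxD
    have h1 : ε ≤ ‖x - x‖ := hx x hxD
    simp at h1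
    linarith

theorem eventually_forall_reflectionDiff_pos {f : E n → ℝ} (hf : Continuous f)
    {K : Set (E n)} (hK : IsCompact K) (hpos : ∀ x ∈ K, 0 < reflectionDiff ν κ f x) :
    ∀ᶠ κ' in 𝓝 κ, ∀ x ∈ K, 0 < reflectionDiff ν κ' f x := by
  refine hK.eventually_forall_of_forall_eventually fun x hx => ?_
  have hc : Continuous fun z : ℝ × E n => reflectionDiff ν z.1 f z.2 := by
    unfold reflectionDiff planeReflection
    fun_prop
  exact (isOpen_lt continuous_const hc).mem_nhds (hpos x hx)

variable {m : ℕ} {U V : ℕ → E n → ℝ} {p q : ℝ}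

/-- The openness half of the continuity argument. One turn through the coupled system maps a common
lower bound `-a` to `-Θ ε² a`, with `Θ` independent of the plane, and `ε` is fixed so that `Θ ε² ≤
1/2`. -/
theorem reflectionDiff_nonneg_beyond (hn : 0 < n) (hm : 0 < m) (hΩo : IsOpen Ω)
    (hΩc : Convex ℝ Ω) (hΩb : Bornology.IsBounded Ω) (hR : ReflectsCaps Ω x₀ ν κ₁)
    (hp : 1 ≤ p) (hq : 1 ≤ q)
    (hU : IsNavierChain Ω m U fun x => V 0 x ^ p) (hV : IsNavierChain Ω m V fun x => U 0 x ^ q)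
    (hUpos : ∀ x ∈ Ω, 0 < U 0 x) (hVpos : ∀ x ∈ Ω, 0 < V 0 x) (hκ : κ ≤ κ₁)
    (h : ∀ x ∈ cap Ω ν κ, 0 ≤ reflectionDiff ν κ (U 0) x ∧ 0 ≤ reflectionDiff ν κ (V 0) x) :
    ∀ᶠ κ' in 𝓝[>] κ, κ' ≤ κ₁ → ∀ x ∈ cap Ω ν κ',
      0 ≤ reflectionDiff ν κ' (U 0) x ∧ 0 ≤ reflectionDiff ν κ' (V 0) x := by
  have hν := hR.norm_eq_one
  have hUg : ∀ x ∈ Ω, 0 < V 0 x ^ p := fun x hx => Real.rpow_pos_of_pos (hVpos x hx) p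
  have hVg : ∀ x ∈ Ω, 0 < U 0 x ^ q := fun x hx => Real.rpow_pos_of_pos (hUpos x hx) q
  obtain ⟨θ, hθ, htop⟩ := exists_forall_neg_le_reflectionDiff_top hn hΩb hR
  obtain ⟨MU, hMU0, hMU⟩ := hU.exists_bound hΩb (i := 0) hm.le
  obtain ⟨MV, hMV0, hMV⟩ := hV.exists_bound hΩb (i := 0) hm.le
  obtain ⟨ρ₀, hρ₀⟩ := hΩb.exists_norm_le
  set ρ := |ρ₀| + ‖x₀‖ + 1 with hρdef
  have hρ : 0 < ρ := by positivity
  have hΩρ : ∀ x ∈ Ω, ∃ z ∉ Ω, ‖x - z‖ < ρ := fun x hx => by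
    refine ⟨x₀, hR.not_mem, ?_⟩
    rw [hρdef]
    linarith [norm_sub_le x x₀, hρ₀ x hx, le_abs_self ρ₀]
  set Λ : ℝ := p * MV ^ (p - 1) + q * MU ^ (q - 1) with hΛ
  have hΛ1 : 0 ≤ p * MV ^ (p - 1) := by positivity
  have hΛ2 : 0 ≤ q * MU ^ (q - 1) := by positivity
  set Θ : ℝ := Λ / θ * (ρ ^ 2) ^ (m - 1) with hΘ
  have hΘ0 : 0 ≤ Θ := by positivity
  obtain ⟨ε, hε, hεΘ⟩ : ∃ ε : ℝ, 0 < ε ∧ Θ * ε ^ 2 ≤ 1 / 2 := by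
    refine ⟨Real.sqrt (1 / (2 * (Θ + 1))), by positivity, ?_⟩
    rw [Real.sq_sqrt (by positivity), mul_one_div, div_le_div_iff₀ (by positivity) (by norm_num)]
    linarith
  -- On this compact inner part positivity survives a small move of the plane, so negative values
  -- occur only within `ε` of the complement of the new cap.
  set K : Set (E n) := {x | ∀ z ∉ cap Ω ν κ, ε / 2 ≤ ‖x - z‖} with hK
  have hKc : IsCompact K := isCompact_forall_le_norm_sub (isBounded_cap hΩb) (half_pos hε)
  have hKcap : K ⊆ cap Ω ν κ := fun x hx => by
    by_contra hxD
    have h1 : ε / 2 ≤ ‖x - x‖ := hx x hxD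
    simp at h1
    linarith
  have hUK := eventually_forall_reflectionDiff_pos (ν := ν) (κ := κ) (hU.continuous 0 hm.le) hKc
    fun x hx => hU.reflectionDiff_pos hn hΩo hΩc hΩb hUg hR hκ
      (reflectionDiff_rpow_nonneg hVpos hp fun x hx => (h x hx).2) hm.le x (hKcap hx)
  have hVK := eventually_forall_reflectionDiff_pos (ν := ν) (κ := κ) (hV.continuous 0 hm.le) hKc
    fun x hx => hV.reflectionDiff_pos hn hΩo hΩc hΩb hVg hR hκ
      (reflectionDiff_rpow_nonneg hUpos hq fun x hx => (h x hx).1) hm.le x (hKcap hx)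
  filter_upwards [nhdsWithin_le_nhds hUK, nhdsWithin_le_nhds hVK, self_mem_nhdsWithin,
    nhdsWithin_le_nhds (Iio_mem_nhds (show κ < κ + ε / 2 by linarith))]
    with κ' hUK' hVK' (hκκ' : κ < κ') (hκε : κ' < κ + ε / 2) hκ'
  have hnear : ∀ x, x ∉ K → ∃ z ∉ cap Ω ν κ', ‖x - z‖ < ε := by
    intro x hx
    have h1 : ∃ z ∉ cap Ω ν κ, ‖x - z‖ < ε / 2 := by
      by_contra! hcon
      exact hx hcon
    obtain ⟨z, hz, hxz⟩ := h1
    exact exists_not_mem_cap_near hν hκκ'.le hκε hz hxz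
  have hestimate : ∀ {W Z : ℕ → E n → ℝ} {r M : ℝ}, 1 ≤ r →
      IsNavierChain Ω m W (fun x => Z 0 x ^ r) → (∀ x ∈ Ω, 0 < Z 0 x) → (∀ x, |Z 0 x| ≤ M) →
      r * M ^ (r - 1) ≤ Λ → (∀ x ∈ K, 0 < reflectionDiff ν κ' (W 0) x) → ∀ a : ℝ, 0 ≤ a →
      (∀ x ∈ cap Ω ν κ', -a ≤ reflectionDiff ν κ' (Z 0) x) →
      ∀ x ∈ cap Ω ν κ', -(a / 2) ≤ reflectionDiff ν κ' (W 0) x := by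
    intro W Z r M hr hW hZ hM hMΛ hWK a ha hZa x hx
    have hg : ∀ x ∈ Ω, 0 < Z 0 x ^ r := fun x hx => Real.rpow_pos_of_pos (hZ x hx) r
    have h1 : ∀ x ∈ cap Ω ν κ', -(Λ * a) ≤ reflectionDiff ν κ' (fun y => Z 0 y ^ r) x := by
      intro x hx
      have hRx := hR.reflection_mem κ' hκ' x (subset_closure hx.1) hx.2
      have e1 := neg_mul_le_rpow_sub_rpow hr ha (hZ x hx.1).le
        ((le_abs_self _).trans (hM x)) (hZ _ hRx).le (hZa x hx)
      have e2 : r * M ^ (r - 1) * a ≤ Λ * a := by gcongr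
      rw [reflectionDiff]
      linarith
    have h2 := htop m W _ hW hg κ' hκ' (Λ * a) (by positivity) h1
    -- The first `m - 1` descents use the crude width `ρ`; the last, from level `1` to level `0`,
    -- uses `ε`, since the inner positivity on `K` is invoked only for level `0`.
    have h3 := hW.neg_mul_pow_le_reflectionDiff hn hΩo hΩc hΩb hg hR hκ' (by positivity) hρ hΩρ
      h2 (i := 1) hm
    have h4 := hW.neg_mul_sq_le_reflectionDiff hn hΩo hΩc hΩb hg hR hκ' hm (by positivity) hε h3
      (fun y _ hneg => hnear y fun hyK => absurd (hWK y hyK) (not_lt.mpr hneg.le)) x hx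
    have h5 : Λ * a / θ * (ρ ^ 2) ^ (m - 1) * ε ^ 2 = (Θ * ε ^ 2) * a := by
      rw [hΘ]; ring
    rw [h5] at h4
    nlinarith [mul_le_mul_of_nonneg_right hεΘ ha]
  refine nonneg_of_forall_neg_le_half (N := 2 * (MU + MV)) (by positivity) (fun x _ => ?_)
    (fun x _ => ?_) fun a ha hab x hx => ⟨?_, ?_⟩
  · have := (abs_le.mp (abs_reflectionDiff_le (ν := ν) (κ := κ') hMU x)).1
    linarith
  · have := (abs_le.mp (abs_reflectionDiff_le (ν := ν) (κ := κ') hMV x)).1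
    linarith
  · exact hestimate hp hU hVpos hMV (by rw [hΛ]; linarith) hUK' a ha
      (fun y hy => (hab y hy).2) x hx
  · exact hestimate hq hV hUpos hMU (by rw [hΛ]; linarith) hVK' a ha
      (fun y hy => (hab y hy).1) x hx

theorem reflectionDiff_nonneg_of_le (hn : 0 < n) (hm : 0 < m) (hΩo : IsOpen Ω)
    (hΩc : Convex ℝ Ω) (hΩb : Bornology.IsBounded Ω) (hR : ReflectsCaps Ω x₀ ν κ₁)
    (hp : 1 ≤ p) (hq : 1 ≤ q)
    (hU : IsNavierChain Ω m U fun x => V 0 x ^ p) (hV : IsNavierChain Ω m V fun x => U 0 x ^ q)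
    (hUpos : ∀ x ∈ Ω, 0 < U 0 x) (hVpos : ∀ x ∈ Ω, 0 < V 0 x) (hκ : κ ≤ κ₁) :
    ∀ x ∈ cap Ω ν κ, 0 ≤ reflectionDiff ν κ (U 0) x ∧ 0 ≤ reflectionDiff ν κ (V 0) x := by
  set S : Set ℝ := {κ | ∀ x ∈ cap Ω ν κ,
    0 ≤ reflectionDiff ν κ (U 0) x ∧ 0 ≤ reflectionDiff ν κ (V 0) x} with hS
  -- For fixed `x` the condition on `κ` is a union of closed sets, so `S` is closed although the
  -- caps vary with `κ`.
  have hSeq : S = ⋂ x ∈ Ω, ({κ | κ ≤ inner ℝ x ν} ∪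
      ({κ | 0 ≤ reflectionDiff ν κ (U 0) x} ∩ {κ | 0 ≤ reflectionDiff ν κ (V 0) x})) := by
    ext κ
    simp only [Set.mem_iInter]
    constructor
    · intro hκ x hx
      by_cases hxκ : κ ≤ inner ℝ x ν
      · exact Or.inl hxκ
      · exact Or.inr (hκ x ⟨hx, not_le.mp hxκ⟩)
    · intro hκ x hx
      rcases hκ x hx.1 with h1 | h1
      · exact absurd (show inner ℝ x ν < κ from hx.2) (not_lt.mpr h1)
      · exact h1
  have hcont : ∀ {f : E n → ℝ}, Continuous f → ∀ x, Continuous fun κ => reflectionDiff ν κ f x := by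
    intro f hf x
    unfold reflectionDiff planeReflection
    fun_prop
  have hSc : IsClosed S := by
    rw [hSeq]
    refine isClosed_biInter fun x _ => (isClosed_le continuous_id continuous_const).union ?_
    exact (isClosed_le continuous_const (hcont (hU.continuous 0 hm.le) x)).inter
      (isClosed_le continuous_const (hcont (hV.continuous 0 hm.le) x))
  have hempty : ∀ κ ≤ inner ℝ x₀ ν, κ ∈ S := fun κ hκ x hx =>
    absurd (show inner ℝ x ν < κ from hx.2)
      (not_lt.mpr (hκ.trans (hR.inner_le x (subset_closure hx.1))))
  have hsub : Set.Icc (inner ℝ x₀ ν) κ₁ ⊆ S := by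
    refine (hSc.inter isClosed_Icc).Icc_subset_of_forall_exists_gt (hempty _ le_rfl) ?_
    rintro κ ⟨hκS, -, hκlt⟩ y (hy : κ < y)
    have h1 := reflectionDiff_nonneg_beyond hn hm hΩo hΩc hΩb hR hp hq hU hV hUpos hVpos
      hκlt.le hκS
    have h2 : ∀ᶠ κ' in 𝓝[>] κ, κ' ∈ S ∩ Set.Ioc κ y := by
      filter_upwards [h1, self_mem_nhdsWithin, nhdsWithin_le_nhds (Iio_mem_nhds hκlt),
        nhdsWithin_le_nhds (Iio_mem_nhds hy)] with κ' e1 (e2 : κ < κ') (e3 : κ' < κ₁) (e4 : κ' < y)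
      exact ⟨e1 e3.le, e2, e4.le⟩
    exact h2.exists
  rcases le_total κ (inner ℝ x₀ ν) with hle | hle
  · exact hempty κ hle
  · exact hsub ⟨hle, hκ⟩

/-- The points `x` and `x + t • ν` are mirror images in the plane of height `⟪x, ν⟫ + t / 2`, which
is admissible because the upper point has height at most `⟪x₀, ν⟫ + δ₀`. If `x` is on the boundary,
the inequality is positivity at its mirror image. -/
theorem IsNavierChain.strictlyIncreasingAlong {g : E n → ℝ} (h : IsNavierChain Ω m U g)
    (hn : 0 < n) (hΩo : IsOpen Ω) (hΩc : Convex ℝ Ω) (hΩb : Bornology.IsBounded Ω)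
    (hg : ∀ x ∈ Ω, 0 < g x) {δ₀ : ℝ} (hR : ReflectsCaps Ω x₀ ν (inner ℝ x₀ ν + δ₀))
    (hw : ∀ κ ≤ inner ℝ x₀ ν + δ₀, ∀ x ∈ cap Ω ν κ, 0 ≤ reflectionDiff ν κ g x)
    {i : ℕ} (hi : i ≤ m) :
    StrictlyIncreasingAlong (U i) ν (boundaryLayer Ω x₀ ν δ₀) := by
  rintro x ⟨hx, -, -⟩ t ht ⟨-, -, hxt⟩
  have hν := hR.norm_eq_one
  set κ := inner ℝ x ν + t / 2 with hκdef
  have hκ : κ ≤ inner ℝ x₀ ν + δ₀ := by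
    rw [inner_sub_left, inner_add_left, real_inner_smul_left, real_inner_self_eq_norm_sq, hν] at hxt
    rw [hκdef]
    linarith
  have hxκ : inner ℝ x ν < κ := by rw [hκdef]; linarith
  have hrefl : planeReflection ν κ x = x + t • ν := by
    rw [planeReflection, hκdef]
    congr 2
    ring
  by_cases hxΩ : x ∈ Ω
  · have h1 := h.reflectionDiff_pos hn hΩo hΩc hΩb hg hR hκ (hw κ hκ) hi x ⟨hxΩ, hxκ⟩
    rw [reflectionDiff, hrefl] at h1
    linarith
  · rw [h.eq_zero i hi x hxΩ, ← hrefl]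
    exact h.pos hn hΩb hg hi _ (hR.reflection_mem κ hκ x hx hxκ)

end MovingPlanes

end LaneEmden

end

theorem theorem1p1 (n : ℕ) (hn : 3 ≤ n) (hodd : Odd n)
    (Ω : Set (LaneEmden.E n)) (hΩ : LaneEmden.IsSmoothStrictlyConvexDomain Ω)
    (x₀ : LaneEmden.E n) (hx₀ : x₀ ∈ frontier Ω)
    (ν : LaneEmden.E n) (hν : LaneEmden.IsUnitInwardNormal Ω x₀ ν) :
    ∃ δ₀ : ℝ, 0 < δ₀ ∧
      ∀ (p q : ℝ), 1 ≤ p → 1 ≤ q → 1 < p * q →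
      ∀ (u v : LaneEmden.E n → ℝ), LaneEmden.IsPositiveClassicalSolution Ω p q u v →
        ∀ i ≤ (n - 1) / 2,
          LaneEmden.StrictlyIncreasingAlong (LaneEmden.negLaplacianPow Ω i u) ν
            (LaneEmden.boundaryLayer Ω x₀ ν δ₀) ∧
          LaneEmden.StrictlyIncreasingAlong (LaneEmden.negLaplacianPow Ω i v) ν
            (LaneEmden.boundaryLayer Ω x₀ ν δ₀) := by
  -- The height comes from the geometry of `Ω` at `x₀` alone, before the exponents and the solutions
  -- are introduced.
  obtain ⟨δ₀, hδ₀, hR⟩ := LaneEmden.exists_reflectsCaps hΩ hx₀ hν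
  refine ⟨δ₀, hδ₀, fun p q hp hq _ u v h i hi => ?_⟩
  have hn0 : 0 < n := by omega
  have hm : 0 < (n - 1) / 2 := by omega
  have hU := LaneEmden.isNavierChain_negLaplacianPow hodd hΩ h.classical_u h.eq_u h.navier_u
  have hV := LaneEmden.isNavierChain_negLaplacianPow hodd hΩ h.classical_v h.eq_v h.navier_v
  have hmain : ∀ κ ≤ inner ℝ x₀ ν + δ₀, ∀ x ∈ LaneEmden.cap Ω ν κ,
      0 ≤ LaneEmden.reflectionDiff ν κ u x ∧ 0 ≤ LaneEmden.reflectionDiff ν κ v x := fun κ hκ =>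
    LaneEmden.reflectionDiff_nonneg_of_le hn0 hm hΩ.isOpen hΩ.convex hΩ.bounded hR hp hq
      (U := fun i => LaneEmden.negLaplacianPow Ω i u)
      (V := fun i => LaneEmden.negLaplacianPow Ω i v) hU hV h.pos_u h.pos_v hκ
  refine ⟨hU.strictlyIncreasingAlong hn0 hΩ.isOpen hΩ.convex hΩ.bounded
      (fun x hx => Real.rpow_pos_of_pos (h.pos_v x hx) p) hR (fun κ hκ => ?_) hi,
    hV.strictlyIncreasingAlong hn0 hΩ.isOpen hΩ.convex hΩ.bounded
      (fun x hx => Real.rpow_pos_of_pos (h.pos_u x hx) q) hR (fun κ hκ => ?_) hi⟩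
  · exact LaneEmden.reflectionDiff_rpow_nonneg h.pos_v hp fun x hx => (hmain κ hκ x hx).2
  · exact LaneEmden.reflectionDiff_rpow_nonneg h.pos_u hq fun x hx => (hmain κ hκ x hx).1
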